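/- **Theorem 2.1.** Let $n\ge 1$ and $r\ge 2$ be integers and let $c_1,C_1,A>0$ and $D$ be real numbers. There is a constant $C>0$, depending only on $n,r,c_1,C_1,A,D$, such that the following holds. Let $\Omega\subset\mathbb{R}^n$ be a polyhedral domain (a bounded connected open set that is the interior of its closure, whose closure is a finite union of simplices) with $\operatorname{diam}\Omega\le D$. Let $\mathcal{T}_h$ be a finite conforming simplicial decomposition of $\overline\Omega$, and let $h_T$ be the diameter of the element $T\in\mathcal{T}_h$. Assume that $\mathcal{T}_h$ is shape regular: each $T\in\mathcal{T}_h$ contains a ball of diameter $c_1h_T$ and is contained in a ball of radius $C_1h_T$. Let $S_h^r$ be the Lagrange finite element space of continuous functions on $\overline\Omega$ whose restriction to each $T\in\mathcal{T}_h$ is a polynomial of degree at most $r-1$, and let $I_h$ be the Lagrange interpolation operator onto $S_h^r$, i.e. $I_hf\in S_h^r$ agrees with $f$ at all points of each $T$ whose barycentric coordinates are integer multiples of $1/(r-1)$. Let $d>0$ and let $\omega\in C^\infty(\Omega)$, continuous up to the boundary of $\Omega$ (so that $I_h(\omega^2\chi)$ is defined), satisfy $$|\omega|_{W^j_\infty(\Omega)}=\max_{|\alpha|=j}\|D^\alpha\omega\|_{L_\infty(\Omega)}\le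 A\,d^{-j},\qquad 0\le j\le r .$$ Then for each $\chi\in S_h^r$ there exists $\eta\in S_h^r$, namely $\eta=I_h(\omega^2\chi)$, such that for each $T\in\mathcal{T}_h$ with $h_T\le d$, $$\|\omega^2\chi-\eta\|_{H^1(T)}\le C\left(\frac{h_T}{d}\,\|\nabla(\omega\chi)\|_{L_2(T)}+\frac{h_T}{d^2}\,\|\chi\|_{L_2(T)}\right),$$ where $\|u\|_{H^1(T)}=\left(\int_T(u^2+|\nabla u|^2)\,dx\right)^{1/2}$. -/

import Mathlib

open MeasureTheory
open scoped ENNReal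

/-- A polyhedral domain, apart from the requirement that its closure is a finite union of
`n`-simplices, which is part of `SimplicialDecomposition`: a nonempty connected open set that lies
on one side of its boundary, in the sense that it is the interior of its closure (no slits). -/
structure IsPolyhedralDomain {n : ℕ} (Ω : Set (EuclideanSpace ℝ (Fin n))) : Prop where
  isOpen : IsOpen Ω
  isConnected : IsConnected Ω
  interior_closure : interior (closure Ω) = Ω

/-- A (finite, conforming) simplicial decomposition of a polyhedral domain `Ω ⊆ ℝⁿ`: a finite
geometric simplicial complex, each of whose faces is a face of an `n`-simplex of the complex, and
whose simplices fill the closure of `Ω`. -/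
structure SimplicialDecomposition {n : ℕ} (Ω : Set (EuclideanSpace ℝ (Fin n))) where
  /-- The underlying simplicial complex; simplices are given by their vertex sets. -/
  complex : Geometry.SimplicialComplex ℝ (EuclideanSpace ℝ (Fin n))
  finite_faces : complex.faces.Finite
  pure : ∀ s ∈ complex.faces, ∃ t ∈ complex.faces, s ⊆ t ∧ t.card = n + 1
  space_eq : complex.space = closure Ω

/-- The closed simplex with the given vertices. -/
def simplexOf {n : ℕ} (s : Finset (EuclideanSpace ℝ (Fin n))) : Set (EuclideanSpace ℝ (Fin n)) :=
  convexHull ℝ (s : Set (EuclideanSpace ℝ (Fin n)))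

/-- The diameter `h_T` of the simplex `T` with the given vertices. -/
noncomputable def simplexDiam {n : ℕ} (s : Finset (EuclideanSpace ℝ (Fin n))) : ℝ :=
  Metric.diam (simplexOf s)

/-- The points of a simplex whose barycentric coordinates are integer multiples of `1 / k`:
the nodes of the Lagrange element of degree `k`. -/
def lagrangeNodes {n : ℕ} (k : ℕ) (s : Finset (EuclideanSpace ℝ (Fin n))) :
    Set (EuclideanSpace ℝ (Fin n)) :=
  {z | ∃ a : EuclideanSpace ℝ (Fin n) → ℕ,
    ∑ v ∈ s, a v = k ∧ z = ∑ v ∈ s, ((a v : ℝ) / (k : ℝ)) • v}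

namespace SimplicialDecomposition

variable {n : ℕ} {Ω : Set (EuclideanSpace ℝ (Fin n))}

/-- The elements of the decomposition: its `n`-dimensional simplices (as vertex sets). -/
def elements (𝒯 : SimplicialDecomposition Ω) : Set (Finset (EuclideanSpace ℝ (Fin n))) :=
  {s | s ∈ 𝒯.complex.faces ∧ s.card = n + 1}

/-- Shape regularity: each element `T` contains a ball of diameter `c₁ h_T` and is contained in a
ball of radius `C₁ h_T`. -/
def ShapeRegular (𝒯 : SimplicialDecomposition Ω) (c₁ C₁ : ℝ) : Prop :=
  ∀ s ∈ 𝒯.elements,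
    (∃ x, Metric.closedBall x (c₁ * simplexDiam s / 2) ⊆ simplexOf s) ∧
    (∃ y, simplexOf s ⊆ Metric.closedBall y (C₁ * simplexDiam s))

/-- The Lagrange finite element space of degree `k`: functions that are continuous on the closure
of `Ω` and coincide on each element with a polynomial of total degree at most `k`.
Values outside the closure of `Ω` are irrelevant. -/
def lagrangeSpace (𝒯 : SimplicialDecomposition Ω) (k : ℕ) :
    Submodule ℝ (EuclideanSpace ℝ (Fin n) → ℝ) where
  carrier := {v | ContinuousOn v (closure Ω) ∧ ∀ s ∈ 𝒯.elements,
    ∃ p : MvPolynomial (Fin n) ℝ, p.totalDegree ≤ k ∧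
      ∀ x ∈ simplexOf s, v x = MvPolynomial.eval (fun i => x i) p}
  zero_mem' := ⟨continuousOn_const, fun _ _ => ⟨0, by simp, by simp⟩⟩
  add_mem' := by
    rintro u v ⟨hu, hu'⟩ ⟨hv, hv'⟩
    refine ⟨hu.add hv, fun s hs => ?_⟩
    obtain ⟨p, hp, hp'⟩ := hu' s hs
    obtain ⟨q, hq, hq'⟩ := hv' s hs
    exact ⟨p + q, (MvPolynomial.totalDegree_add p q).trans (max_le hp hq),
      fun x hx => by simp [hp' x hx, hq' x hx]⟩
  smul_mem' := by
    rintro c v ⟨hv, hv'⟩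
    refine ⟨hv.const_smul c, fun s hs => ?_⟩
    obtain ⟨p, hp, hp'⟩ := hv' s hs
    exact ⟨c • p, (MvPolynomial.totalDegree_smul_le c p).trans hp,
      fun x hx => by simp [hp' x hx]⟩

/-- `η` is the Lagrange interpolant `I_h f` of degree `k`: it belongs to the finite element space
and takes the values of `f` at all Lagrange nodes (this determines `η` on the closure of `Ω`). -/
def IsLagrangeInterpolant (𝒯 : SimplicialDecomposition Ω) (k : ℕ)
    (f η : EuclideanSpace ℝ (Fin n) → ℝ) : Prop :=
  η ∈ 𝒯.lagrangeSpace k ∧ ∀ s ∈ 𝒯.elements, ∀ z ∈ lagrangeNodes k s, η z = f z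

end SimplicialDecomposition

/-- The norm `‖u‖_{L₂(U)}`. -/
noncomputable def l2Norm {n : ℕ} (u : EuclideanSpace ℝ (Fin n) → ℝ)
    (U : Set (EuclideanSpace ℝ (Fin n))) : ℝ≥0∞ :=
  eLpNorm u 2 (volume.restrict U)

/-- The seminorm `‖∇u‖_{L₂(U)}`, for `u` differentiable on the open set `U`. -/
noncomputable def gradL2Norm {n : ℕ} (u : EuclideanSpace ℝ (Fin n) → ℝ)
    (U : Set (EuclideanSpace ℝ (Fin n))) : ℝ≥0∞ :=
  eLpNorm (fun x => gradient u x) 2 (volume.restrict U)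

/-- The norm `‖u‖_{H¹(U)} = (∫_U u² + |∇u|²)^{1/2}`, for `u` continuously differentiable on the
open set `U` (so that the classical gradient is the weak one). -/
noncomputable def h1Norm {n : ℕ} (u : EuclideanSpace ℝ (Fin n) → ℝ)
    (U : Set (EuclideanSpace ℝ (Fin n))) : ℝ≥0∞ :=
  (l2Norm u U ^ 2 + gradL2Norm u U ^ 2) ^ (1 / 2 : ℝ)

/-- The seminorm `|u|_{W^j_∞(U)} = max_{|α| = j} ‖D^α u‖_{L_∞(U)}`, for `u` smooth on the open set
`U`. A partial derivative `D^α u` of order `j` is written as the derivative of order `j` in the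
directions `e_{i 0}, …, e_{i (j-1)}`. -/
noncomputable def wInftySeminorm {n : ℕ} (j : ℕ) (u : EuclideanSpace ℝ (Fin n) → ℝ)
    (U : Set (EuclideanSpace ℝ (Fin n))) : ℝ≥0∞ :=
  ⨆ i : Fin j → Fin n,
    eLpNorm (fun x => iteratedFDeriv ℝ j u x (fun l => EuclideanSpace.single (i l) (1 : ℝ)))
      ⊤ (volume.restrict U)

/-
On an element `T` of diameter `h ≤ d`, containing `x₀`, let `p` be the polynomial `χ|_T`. The
polynomial `q = ω(x₀)² p + 2 ω(x₀) p(x₀) Dω(x₀)(x - x₀)` has degree at most `r - 1` because `r ≥ 2`,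
so interpolation reproduces it and the error for `ω² p` is the error for `g = ω² p - q`. Since
`g(x₀) = 0`, both `g` and its interpolant are controlled by `h ‖∇g‖_∞`, and the `H¹` error follows
from an inverse estimate. In `∇g` the critical term `(ω² - ω(x₀)²) ∇p` is at most a constant times
`(h/d) |ω(x₀)| |∇p| + (h/d)² |∇p|`: the first part is traded for `∇(ωp)`, from which `ω(x₀) ∇p`
differs by `O(|p|/d + (h/d) |∇p|)`, and in the second one `h |∇p|` is bounded by inverse estimates.
The inverse estimate holds on every set between two concentric balls of comparable radii, by
rescaling the equivalence of norms on the finite-dimensional space of polynomials.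
-/

section PolynomialFunctions

variable {E F : Type*} {k m : ℕ}

section Algebra

variable [AddCommGroup E] [Module ℝ E] [AddCommGroup F] [Module ℝ F] {u v : E → ℝ}

variable (E) in
/-- The real-valued affine functions on `E`, as a subspace of the algebra of all functions. -/
def affineFun : Submodule ℝ (E → ℝ) :=
  LinearMap.range
    ({ toFun := fun f => f, map_add' := fun _ _ => rfl, map_smul' := fun _ _ => rfl } :
      (E →ᵃ[ℝ] ℝ) →ₗ[ℝ] E → ℝ)

variable (E) in
/-- The polynomial functions of degree at most `k` on `E`, encoded without coordinates as the span
of the `k`-fold products of affine functions. -/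
def polyFun (k : ℕ) : Submodule ℝ (E → ℝ) :=
  affineFun E ^ k

theorem affineMap_mem_polyFun (f : E →ᵃ[ℝ] ℝ) : ⇑f ∈ polyFun E 1 := by
  rw [polyFun, pow_one]
  exact ⟨f, rfl⟩

theorem mul_mem_polyFun (hu : u ∈ polyFun E k) (hv : v ∈ polyFun E m) :
    u * v ∈ polyFun E (k + m) := by
  rw [polyFun, pow_add]
  exact Submodule.mul_mem_mul hu hv

theorem polyFun_mono : Monotone (polyFun E) :=
  pow_right_monotone <| Submodule.one_le.2 ⟨AffineMap.const ℝ E 1, rfl⟩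

theorem const_mem_polyFun (k : ℕ) (c : ℝ) : (fun _ => c) ∈ polyFun E k :=
  polyFun_mono k.zero_le <| by
    rw [polyFun, pow_zero]
    exact Submodule.mem_one.2 ⟨c, rfl⟩

theorem affine_mul_mem_polyFun (f : E →ᵃ[ℝ] ℝ) (hu : u ∈ polyFun E k) :
    ⇑f * u ∈ polyFun E (k + 1) :=
  add_comm 1 k ▸ mul_mem_polyFun (affineMap_mem_polyFun f) hu

@[elab_as_elim]
theorem polyFun_induction {P : (k : ℕ) → (u : E → ℝ) → u ∈ polyFun E k → Prop}
    (const : ∀ c, P 0 (fun _ => c) (const_mem_polyFun 0 c))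
    (add : ∀ k u v hu hv, P k u hu → P k v hv → P k (u + v) (Submodule.add_mem _ hu hv))
    (affine_mul : ∀ (f : E →ᵃ[ℝ] ℝ) k u (hu : u ∈ polyFun E k), P k u hu →
      P (k + 1) (⇑f * u) (affine_mul_mem_polyFun f hu))
    (hu : u ∈ polyFun E k) : P k u hu := by
  refine Submodule.pow_induction_on_left' (C := P) (affineFun E) const
    (fun u v k hu hv => add k u v hu hv) ?_ hu
  rintro _ ⟨f, rfl⟩ k u hu h
  exact affine_mul f k u hu h

theorem prod_mem_polyFun {ι : Type*} (s : Finset ι) (d : ι → ℕ) (w : ι → E → ℝ)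
    (hw : ∀ i ∈ s, w i ∈ polyFun E (d i)) : ∏ i ∈ s, w i ∈ polyFun E (∑ i ∈ s, d i) := by
  classical
  induction s using Finset.induction_on with
  | empty => exact const_mem_polyFun 0 1
  | insert i s hi ih =>
    rw [Finset.prod_insert hi, Finset.sum_insert hi]
    exact mul_mem_polyFun (hw i (s.mem_insert_self i))
      (ih fun j hj => hw j (Finset.mem_insert_of_mem hj))

theorem pow_mem_polyFun (hu : u ∈ polyFun E m) (i : ℕ) : u ^ i ∈ polyFun E (i * m) := by
  simpa using prod_mem_polyFun (Finset.range i) (fun _ => m) (fun _ => u) fun _ _ => hu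

theorem polynomial_eval_mem_polyFun (p : Polynomial ℝ) (f : E →ᵃ[ℝ] ℝ) :
    (fun x => p.eval (f x)) ∈ polyFun E p.natDegree := by
  have h : (fun x => p.eval (f x)) = ∑ i ∈ Finset.range (p.natDegree + 1),
      p.coeff i • ⇑f ^ i := by
    ext x
    simp [p.eval_eq_sum_range]
  rw [h]
  refine Submodule.sum_mem _ fun i hi => Submodule.smul_mem _ _ ?_
  exact polyFun_mono (by simpa [Nat.lt_succ_iff] using hi)
    (pow_mem_polyFun (affineMap_mem_polyFun f) i)

theorem comp_affineMap_mem_polyFun (hu : u ∈ polyFun E k) (f : F →ᵃ[ℝ] E) :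
    u ∘ f ∈ polyFun F k := by
  induction hu using polyFun_induction with
  | const c => exact const_mem_polyFun 0 c
  | add k u v _ _ hu hv => exact Submodule.add_mem _ hu hv
  | affine_mul g k u _ hu => exact affine_mul_mem_polyFun (g.comp f) hu

instance finiteDimensional_polyFun [FiniteDimensional ℝ E] :
    FiniteDimensional ℝ (polyFun E k) := by
  have : Module.Finite ℝ (E →ᵃ[ℝ] ℝ) :=
    .equiv (AffineMap.toConstProdLinearMap ℝ (V1 := E) (V2 := ℝ)).symm
  exact Module.Finite.iff_fg.2 (Submodule.FG.pow (Module.Finite.iff_fg.1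
    (LinearMap.finiteDimensional_range _)) k)

end Algebra

section Calculus

variable [NormedAddCommGroup E] [NormedSpace ℝ E] [FiniteDimensional ℝ E] {u : E → ℝ}

theorem hasFDerivAt_affineMap (f : E →ᵃ[ℝ] ℝ) (x : E) :
    HasFDerivAt f f.linear.toContinuousLinearMap x := by
  rw [f.decomp]
  exact f.linear.toContinuousLinearMap.hasFDerivAt.add_const (f 0)

theorem contDiff_of_mem_polyFun {N : WithTop ℕ∞} (hu : u ∈ polyFun E k) : ContDiff ℝ N u := by
  induction hu using polyFun_induction with
  | const c => exact contDiff_const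
  | add _ u v _ _ hu hv => exact hu.add hv
  | affine_mul f _ u _ hu =>
    exact ContDiff.mul (⟨f, f.continuous_of_finiteDimensional⟩ : E →ᴬ[ℝ] ℝ).contDiff hu

theorem differentiable_of_mem_polyFun (hu : u ∈ polyFun E k) : Differentiable ℝ u :=
  (contDiff_of_mem_polyFun (N := 1) hu).differentiable one_ne_zero

theorem fderiv_apply_mem_polyFun (hu : u ∈ polyFun E k) (e : E) :
    (fun x => fderiv ℝ u x e) ∈ polyFun E k := by
  induction hu using polyFun_induction with
  | const c => simpa using const_mem_polyFun (E := E) 0 0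
  | add k u v hu hv ihu ihv =>
    convert Submodule.add_mem _ ihu ihv using 1
    ext x
    rw [fderiv_add (differentiable_of_mem_polyFun hu x) (differentiable_of_mem_polyFun hv x)]
    rfl
  | affine_mul f k u hu ih =>
    convert Submodule.add_mem _ (affine_mul_mem_polyFun f ih)
      ((polyFun E (k + 1)).smul_mem (f.linear e) (polyFun_mono k.le_succ hu)) using 1
    ext x
    rw [((hasFDerivAt_affineMap f x).mul (differentiable_of_mem_polyFun hu x).hasFDerivAt).fderiv]
    simp [mul_comm]

theorem eq_zero_of_mem_polyFun_of_isOpen {U : Set E} (hu : u ∈ polyFun E k) (hU : IsOpen U)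
    (hne : U.Nonempty) (h : ∀ x ∈ U, u x = 0) : u = 0 := by
  obtain ⟨x, hx⟩ := hne
  have hu' : AnalyticOnNhd ℝ u Set.univ := fun y _ =>
    (contDiff_of_mem_polyFun hu).contDiffAt.analyticAt
  exact hu'.eq_of_eventuallyEq (fun _ _ => analyticAt_const)
    (Filter.eventually_of_mem (hU.mem_nhds hx) h)

end Calculus

section Coordinates

variable [AddCommGroup E] [Module ℝ E] {ι : Type*} (b : Module.Basis ι ℝ E)
  {u : E → ℝ}

theorem eval_repr_mem_polyFun {p : MvPolynomial ι ℝ} (hp : p.totalDegree ≤ k) :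
    (fun x => MvPolynomial.eval (b.repr x) p) ∈ polyFun E k := by
  have h : (fun x => MvPolynomial.eval (b.repr x) p) =
      ∑ a ∈ p.support, p.coeff a • ∏ i ∈ a.support, ⇑(b.coord i).toAffineMap ^ a i := by
    ext x
    simp [MvPolynomial.eval_eq]
  rw [h]
  refine Submodule.sum_mem _ fun a ha => Submodule.smul_mem _ _ ?_
  exact polyFun_mono ((MvPolynomial.le_totalDegree ha).trans hp) (prod_mem_polyFun _ a _ fun i _ =>
    by simpa using pow_mem_polyFun (affineMap_mem_polyFun (b.coord i).toAffineMap) (a i))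

theorem exists_mvPolynomial_of_mem_polyFun [Finite ι] (hu : u ∈ polyFun E k) :
    ∃ p : MvPolynomial ι ℝ, p.totalDegree ≤ k ∧ ∀ x, u x = MvPolynomial.eval (b.repr x) p := by
  cases nonempty_fintype ι
  induction hu using polyFun_induction with
  | const c => exact ⟨.C c, by simp⟩
  | add k u v _ _ hu hv =>
    obtain ⟨p, hp, hup⟩ := hu
    obtain ⟨q, hq, hvq⟩ := hv
    exact ⟨p + q, (MvPolynomial.totalDegree_add p q).trans (max_le hp hq), by simp [hup, hvq]⟩
  | affine_mul f k u _ hu =>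
    obtain ⟨p, hp, hup⟩ := hu
    let q : MvPolynomial ι ℝ := ∑ i, .C (f.linear (b i)) * .X i + .C (f 0)
    have hq : q.totalDegree ≤ 1 := by
      refine (MvPolynomial.totalDegree_add _ _).trans (max_le ?_ (by simp))
      exact MvPolynomial.totalDegree_finsetSum_le fun i _ =>
        (MvPolynomial.totalDegree_mul _ _).trans (by simp)
    have hfq : ∀ x, f x = MvPolynomial.eval (b.repr x) q := fun x => by
      conv_lhs => rw [f.decomp, Pi.add_apply, ← b.sum_repr x, map_sum]
      simp [q, mul_comm]
    refine ⟨q * p, ?_, fun x => by simp [hfq, hup]⟩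
    linarith [MvPolynomial.totalDegree_mul q p]

end Coordinates

end PolynomialFunctions

section Unisolvence

theorem mvPolynomial_eq_zero_of_eval_natCast_eq_zero {R σ : Type*} [CommRing R] [IsDomain R]
    [CharZero R] [Fintype σ] {k : ℕ} {p : MvPolynomial σ R} (hp : p.totalDegree ≤ k)
    (h : ∀ a : σ → ℕ, ∑ i, a i ≤ k → MvPolynomial.eval (fun i => (a i : R)) p = 0) : p = 0 := by
  classical
  by_contra hp0
  obtain ⟨t, ht, htd⟩ : ∃ t ∈ p.support, p.totalDegree = t.degree :=
    Finset.exists_mem_eq_sup p.support (MvPolynomial.support_nonempty.2 hp0)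
      fun m => m.sum fun _ e => e
  obtain ⟨x, hx, hxp⟩ := MvPolynomial.combinatorial_nullstellensatz_exists_eval_nonzero p t
    (MvPolynomial.mem_support_iff.1 ht) htd
    (fun i => (Finset.range (t i + 1)).image (Nat.cast : ℕ → R)) fun i => by
      rw [Finset.card_image_of_injective _ Nat.cast_injective, Finset.card_range]
      exact Nat.lt_succ_self _
  have hx' : ∀ i, ∃ a : ℕ, a ≤ t i ∧ (a : R) = x i := by
    simpa only [Finset.mem_image, Finset.mem_range, Nat.lt_succ_iff] using hx
  choose a ha hax using hx'
  refine hxp (funext hax ▸ h a ((Finset.sum_le_sum fun i _ => ha i).trans ?_))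
  rwa [← Finsupp.degree_eq_sum, ← htd]

variable {E ι : Type*} [AddCommGroup E] [Module ℝ E] [Fintype ι] {k : ℕ}

/-- The node of the Lagrange element of degree `k` with vertices `v i` whose barycentric
coordinates are `a i / k`. -/
noncomputable def lagrangeNode (k : ℕ) (v : ι → E) (a : ι → ℕ) : E :=
  ∑ i, ((a i : ℝ) / k) • v i

theorem lagrangeNode_mem_convexHull (hk : k ≠ 0) (v : ι → E) {a : ι → ℕ} (ha : ∑ i, a i = k) :
    lagrangeNode k v a ∈ convexHull ℝ (Set.range v) := by
  have h : ∑ i, (a i : ℝ) / k = 1 := by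
    rw [← Finset.sum_div, div_eq_one_iff_eq (Nat.cast_ne_zero.2 hk)]
    exact_mod_cast ha
  exact (convex_convexHull ℝ _).sum_mem (fun i _ => by positivity) h fun i _ =>
    subset_convexHull ℝ _ (Set.mem_range_self i)

open Classical in
/-- The affine map sending `y` to the point whose barycentric coordinates with respect to the
vertices `v i`, apart from that of the vertex `v i₀`, are `y i / k`. -/
noncomputable def latticeMap (k : ℕ) (v : ι → E) (i₀ : ι) : ({i // i ≠ i₀} → ℝ) →ᵃ[ℝ] E :=
  (Fintype.linearCombination ℝ fun i : {i // i ≠ i₀} => (k : ℝ)⁻¹ • (v i - v i₀)).toAffineMap +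
    AffineMap.const ℝ _ (v i₀)

theorem latticeMap_apply (hk : k ≠ 0) (v : ι → E) (i₀ : ι) {y : ι → ℝ} (hy : ∑ i, y i = k) :
    latticeMap k v i₀ (fun i => y i) = ∑ i, (y i / k) • v i := by
  classical
  have hy' : ∑ i, y i / k = 1 := by
    rw [← Finset.sum_div, hy, div_self (Nat.cast_ne_zero.2 hk)]
  have h : ∑ i, (y i / k) • v i = ∑ i, (y i / k) • (v i - v i₀) + v i₀ := by
    simp only [smul_sub, Finset.sum_sub_distrib, ← Finset.sum_smul, hy', one_smul, sub_add_cancel]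
  rw [h, Fintype.sum_eq_add_sum_subtype_ne _ i₀]
  simp [latticeMap, Fintype.linearCombination_apply, smul_smul, div_eq_mul_inv]

theorem eq_zero_of_forall_lagrangeNode (hk : k ≠ 0) {u : E → ℝ} (hu : u ∈ polyFun E k) {v : ι → E}
    (h : ∀ a : ι → ℕ, ∑ i, a i = k → u (lagrangeNode k v a) = 0) {w : ι → ℝ} (hw : ∑ i, w i = 1) :
    u (∑ i, w i • v i) = 0 := by
  classical
  obtain ⟨i₀, -, -⟩ := Finset.exists_ne_zero_of_sum_ne_zero (hw.trans_ne one_ne_zero)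
  obtain ⟨p, hp, hup⟩ := exists_mvPolynomial_of_mem_polyFun (Pi.basisFun ℝ {i // i ≠ i₀})
    (comp_affineMap_mem_polyFun hu (latticeMap k v i₀))
  have hp_eval : ∀ y : ι → ℝ, ∑ i, y i = k →
      MvPolynomial.eval (fun i : {i // i ≠ i₀} => y i) p = u (∑ i, (y i / k) • v i) := by
    intro y hy
    rw [← latticeMap_apply hk v i₀ hy]
    exact (hup _).symm
  have hp0 : p = 0 := mvPolynomial_eq_zero_of_eval_natCast_eq_zero hp fun a ha => by
    let c : ι → ℕ := fun i => if hi : i = i₀ then k - ∑ i, a i else a ⟨i, hi⟩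
    have hca : ∀ i : {i // i ≠ i₀}, c i = a i := fun i => dif_neg i.2
    have hc : ∑ i, c i = k := by
      simp only [Fintype.sum_eq_add_sum_subtype_ne _ i₀, hca]
      simp [c, ha]
    have := hp_eval (fun i => c i) (mod_cast hc)
    simp only [hca] at this
    exact this.trans (h c hc)
  have := hp_eval (fun i => k * w i) (by rw [← Finset.mul_sum, hw, mul_one])
  simpa [hp0, hk] using this.symm

end Unisolvence

section Interpolation

variable {E ι : Type*} [AddCommGroup E] [Module ℝ E] [Fintype ι] {k : ℕ}

theorem choose_eq_eval_descPochhammer (t : ℝ) (m : ℕ) :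
    Ring.choose t m = (m.factorial : ℝ)⁻¹ * (descPochhammer ℝ m).eval t := by
  rw [Ring.choose_eq_smul, smul_eq_mul, ← Polynomial.aeval_eq_smeval, Polynomial.aeval_def,
    Polynomial.eval₂_eq_eval_map, algebraMap_int_eq, descPochhammer_map]

theorem abs_choose_le {t : ℝ} {m : ℕ} (ht : 0 ≤ t) (htk : t ≤ k) (hm : m ≤ k) :
    |Ring.choose t m| ≤ (k : ℝ) ^ m := by
  rw [choose_eq_eval_descPochhammer, descPochhammer_eval_eq_prod_range, abs_mul, Finset.abs_prod]
  have hfac : |(m.factorial : ℝ)⁻¹| ≤ 1 := by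
    rw [abs_of_nonneg (by positivity)]
    exact inv_le_one_of_one_le₀ (mod_cast m.factorial_pos)
  have hprod : ∏ i ∈ Finset.range m, |t - i| ≤ ∏ _i ∈ Finset.range m, (k : ℝ) := by
    refine Finset.prod_le_prod (fun _ _ => abs_nonneg _) fun i hi => ?_
    have : (i : ℝ) ≤ k := mod_cast (Finset.mem_range.1 hi).le.trans hm
    exact abs_sub_le_of_nonneg_of_le ht htk i.cast_nonneg this
  rw [Finset.prod_const, Finset.card_range] at hprod
  exact (mul_le_of_le_one_left (by positivity) hfac).trans hprod

theorem card_piAntidiag_univ [DecidableEq ι] (k : ℕ) :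
    (Finset.univ.piAntidiag k : Finset (ι → ℕ)).card = (Fintype.card ι + k - 1).choose k := by
  rw [← Finset.map_sym_eq_piAntidiag, Finset.card_map, Finset.sym_univ, Finset.card_univ,
    Sym.card_sym_eq_choose]

variable (b : AffineBasis ι ℝ E)

/-- The Lagrange basis function of degree `k` of the node with barycentric coordinates `a i / k`.
-/
noncomputable def lagrangeBasis (k : ℕ) (a : ι → ℕ) (x : E) : ℝ :=
  ∏ i, Ring.choose (k * b.coord i x) (a i)

open Classical in
/-- The Lagrange interpolation operator of degree `k` on the simplex with vertices `b i`. -/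
noncomputable def lagrangeInterpolation (k : ℕ) : (E → ℝ) →ₗ[ℝ] E → ℝ :=
  ∑ a ∈ Finset.univ.piAntidiag k,
    (LinearMap.proj (lagrangeNode k b a)).smulRight (lagrangeBasis b k a)

open Classical in
theorem lagrangeInterpolation_apply (f : E → ℝ) (x : E) :
    lagrangeInterpolation b k f x =
      ∑ a ∈ Finset.univ.piAntidiag k, f (lagrangeNode k b a) * lagrangeBasis b k a x := by
  simp [lagrangeInterpolation]

theorem lagrangeBasis_mem_polyFun (a : ι → ℕ) : lagrangeBasis b k a ∈ polyFun E (∑ i, a i) := by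
  have h : lagrangeBasis b k a = ∏ i, fun x => Ring.choose (k * b.coord i x) (a i) := by
    ext x
    simp [lagrangeBasis]
  rw [h]
  refine prod_mem_polyFun _ _ _ fun i _ => ?_
  have hp := polynomial_eval_mem_polyFun (descPochhammer ℝ (a i)) ((k : ℝ) • b.coord i)
  rw [descPochhammer_natDegree] at hp
  convert Submodule.smul_mem _ ((a i).factorial : ℝ)⁻¹ hp using 1
  ext x
  simp [choose_eq_eval_descPochhammer]

theorem lagrangeInterpolation_mem_polyFun (f : E → ℝ) :
    lagrangeInterpolation b k f ∈ polyFun E k := by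
  classical
  have h : lagrangeInterpolation b k f =
      ∑ a ∈ Finset.univ.piAntidiag k, f (lagrangeNode k b a) • lagrangeBasis b k a := by
    ext x
    simp [lagrangeInterpolation_apply]
  rw [h]
  refine Submodule.sum_mem _ fun a ha => Submodule.smul_mem _ _ ?_
  exact (Finset.mem_piAntidiag.1 ha).1 ▸ lagrangeBasis_mem_polyFun b a

theorem coord_lagrangeNode (hk : k ≠ 0) {a : ι → ℕ} (ha : ∑ i, a i = k) (i : ι) :
    b.coord i (lagrangeNode k b a) = a i / k := by
  have h : ∑ i, (a i : ℝ) / k = 1 := by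
    rw [← Finset.sum_div, div_eq_one_iff_eq (Nat.cast_ne_zero.2 hk)]
    exact_mod_cast ha
  rw [lagrangeNode, ← Finset.affineCombination_eq_linear_combination _ _ _ h]
  exact b.coord_apply_combination_of_mem (Finset.mem_univ i) h

theorem lagrangeBasis_lagrangeNode (hk : k ≠ 0) {a c : ι → ℕ} (ha : ∑ i, a i = k)
    (hc : ∑ i, c i = k) : lagrangeBasis b k a (lagrangeNode k b c) = if a = c then 1 else 0 := by
  have h : lagrangeBasis b k a (lagrangeNode k b c) = ∏ i, ((c i).choose (a i) : ℝ) := by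
    refine Finset.prod_congr rfl fun i _ => ?_
    rw [coord_lagrangeNode b hk hc, mul_div_cancel₀ _ (Nat.cast_ne_zero.2 hk), Ring.choose_natCast]
  rw [h]
  split_ifs with hac
  · simp [hac]
  · obtain ⟨i, hi⟩ : ∃ i, c i < a i := by
      by_contra! hle
      exact hac (funext fun i => (Finset.sum_eq_sum_iff_of_le fun i _ => hle i).1
        (ha.trans hc.symm) i (Finset.mem_univ i))
    refine Finset.prod_eq_zero (Finset.mem_univ i) ?_
    rw [Nat.choose_eq_zero_of_lt hi, Nat.cast_zero]

theorem lagrangeInterpolation_lagrangeNode (hk : k ≠ 0) (f : E → ℝ) {a : ι → ℕ}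
    (ha : ∑ i, a i = k) :
    lagrangeInterpolation b k f (lagrangeNode k b a) = f (lagrangeNode k b a) := by
  classical
  rw [lagrangeInterpolation_apply, Finset.sum_eq_single_of_mem a (by simpa using ha)]
  · simp [lagrangeBasis_lagrangeNode b hk ha ha]
  · intro c hc hca
    rw [lagrangeBasis_lagrangeNode b hk (Finset.mem_piAntidiag.1 hc).1 ha, if_neg hca, mul_zero]

theorem lagrangeInterpolation_of_mem_polyFun (hk : k ≠ 0) {q : E → ℝ} (hq : q ∈ polyFun E k) :
    lagrangeInterpolation b k q = q := by
  ext x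
  rw [← b.linear_combination_coord_eq_self x, ← sub_eq_zero]
  exact eq_zero_of_forall_lagrangeNode hk
    (Submodule.sub_mem _ (lagrangeInterpolation_mem_polyFun b q) hq)
    (fun a ha => sub_eq_zero.2 (lagrangeInterpolation_lagrangeNode b hk q ha))
    (b.sum_coord_apply_eq_one x)

theorem sub_lagrangeInterpolation_sub (hk : k ≠ 0) (f : E → ℝ) {q : E → ℝ}
    (hq : q ∈ polyFun E k) :
    f - q - lagrangeInterpolation b k (f - q) = f - lagrangeInterpolation b k f := by
  rw [map_sub, lagrangeInterpolation_of_mem_polyFun b hk hq, sub_sub_sub_cancel_right]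

theorem abs_lagrangeBasis_le {a : ι → ℕ} (ha : ∑ i, a i = k) {x : E}
    (hx : x ∈ convexHull ℝ (Set.range b)) : |lagrangeBasis b k a x| ≤ (k : ℝ) ^ k := by
  rw [b.convexHull_eq_nonneg_coord] at hx
  have hx' : ∀ i, b.coord i x ≤ 1 := fun i =>
    b.sum_coord_apply_eq_one x ▸ Finset.single_le_sum (fun j _ => hx j) (Finset.mem_univ i)
  calc |lagrangeBasis b k a x| = ∏ i, |Ring.choose (k * b.coord i x) (a i)| := Finset.abs_prod _ _
    _ ≤ ∏ i, (k : ℝ) ^ a i := by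
      refine Finset.prod_le_prod (fun _ _ => abs_nonneg _) fun i _ => abs_choose_le ?_ ?_ ?_
      · exact mul_nonneg k.cast_nonneg (hx i)
      · exact mul_le_of_le_one_right k.cast_nonneg (hx' i)
      · exact ha ▸ Finset.single_le_sum (fun _ _ => Nat.zero_le _) (Finset.mem_univ i)
    _ = (k : ℝ) ^ k := by rw [Finset.prod_pow_eq_pow_sum, ha]

/-- A bound for the Lebesgue constant of Lagrange interpolation of degree `k` on a simplex with `m`
vertices: the number of nodes times a bound for the basis functions. -/
noncomputable def lebesgueBound (m k : ℕ) : ℝ :=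
  (m + k - 1).choose k * (k : ℝ) ^ k

theorem lebesgueBound_nonneg (m k : ℕ) : 0 ≤ lebesgueBound m k := by
  unfold lebesgueBound
  positivity

theorem abs_lagrangeInterpolation_le {f : E → ℝ} {M : ℝ}
    (hf : ∀ a : ι → ℕ, ∑ i, a i = k → |f (lagrangeNode k b a)| ≤ M) {x : E}
    (hx : x ∈ convexHull ℝ (Set.range b)) :
    |lagrangeInterpolation b k f x| ≤ lebesgueBound (Fintype.card ι) k * M := by
  classical
  rw [lagrangeInterpolation_apply, lebesgueBound, ← card_piAntidiag_univ, mul_assoc, ← nsmul_eq_mul]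
  refine (Finset.abs_sum_le_sum_abs _ _).trans (Finset.sum_le_card_nsmul _ _ _ fun a ha => ?_)
  have ha' := (Finset.mem_piAntidiag.1 ha).1
  rw [abs_mul, mul_comm]
  exact mul_le_mul (abs_lagrangeBasis_le b ha' hx) (hf a ha') (abs_nonneg _) (by positivity)

theorem abs_sub_lagrangeInterpolation_le (hk : k ≠ 0) {f : E → ℝ} {M : ℝ}
    (hf : ∀ y ∈ convexHull ℝ (Set.range b), |f y| ≤ M) {x : E}
    (hx : x ∈ convexHull ℝ (Set.range b)) :
    |f x - lagrangeInterpolation b k f x| ≤ (1 + lebesgueBound (Fintype.card ι) k) * M := by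
  rw [add_mul, one_mul]
  exact (abs_sub _ _).trans (add_le_add (hf x hx)
    (abs_lagrangeInterpolation_le b (fun a ha => hf _ (lagrangeNode_mem_convexHull hk b ha)) hx))

end Interpolation

section GlobalInterpolation

variable {n k : ℕ} {s t : Finset (EuclideanSpace ℝ (Fin n))}

theorem isCompact_simplexOf (s : Finset (EuclideanSpace ℝ (Fin n))) : IsCompact (simplexOf s) :=
  s.finite_toSet.isCompact_convexHull ℝ

theorem mem_lagrangeNodes_iff {z : EuclideanSpace ℝ (Fin n)} :
    z ∈ lagrangeNodes k s ↔ ∃ a : s → ℕ, ∑ v, a v = k ∧ z = lagrangeNode k (↑) a := by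
  classical
  constructor
  · rintro ⟨a, ha, rfl⟩
    exact ⟨fun v => a v, (Finset.sum_coe_sort s a).trans ha,
      (Finset.sum_coe_sort s fun v => ((a v : ℝ) / k) • v).symm⟩
  · rintro ⟨a, ha, rfl⟩
    refine ⟨fun v => if hv : v ∈ s then a ⟨v, hv⟩ else 0, ?_, ?_⟩
    · rw [← Finset.sum_coe_sort, ← ha]
      simp
    · rw [← Finset.sum_coe_sort]
      simp [lagrangeNode]

theorem lagrangeNodes_mono (hst : s ⊆ t) : lagrangeNodes k s ⊆ lagrangeNodes k t := by
  classical
  rintro _ ⟨a, ha, rfl⟩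
  refine ⟨fun v => if v ∈ s then a v else 0, ?_, ?_⟩
  · rw [← ha, Finset.sum_ite_mem, Finset.inter_eq_right.2 hst]
  · rw [← Finset.sum_subset hst fun v _ hv => by simp [hv]]
    exact Finset.sum_congr rfl fun v hv => by simp [hv]

theorem lagrangeNodes_subset_simplexOf (hk : k ≠ 0) : lagrangeNodes k s ⊆ simplexOf s := by
  intro z hz
  obtain ⟨a, ha, rfl⟩ := mem_lagrangeNodes_iff.1 hz
  simpa [simplexOf] using lagrangeNode_mem_convexHull hk ((↑) : s → EuclideanSpace ℝ (Fin n)) ha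

theorem eqOn_simplexOf_of_eqOn_lagrangeNodes (hk : k ≠ 0) {u v : EuclideanSpace ℝ (Fin n) → ℝ}
    (hu : u ∈ polyFun _ k) (hv : v ∈ polyFun _ k) (h : Set.EqOn u v (lagrangeNodes k s)) :
    Set.EqOn u v (simplexOf s) := by
  intro x hx
  obtain ⟨w, -, hw, rfl⟩ := Finset.mem_convexHull'.1 hx
  rw [← Finset.sum_coe_sort] at hw
  rw [← sub_eq_zero, ← Finset.sum_coe_sort s fun v => w v • v]
  exact eq_zero_of_forall_lagrangeNode hk (Submodule.sub_mem _ hu hv) (fun a ha =>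
    sub_eq_zero.2 (h (mem_lagrangeNodes_iff.2 ⟨a, ha, rfl⟩))) hw

theorem exists_mem_polyFun_of_mem_lagrangeSpace {Ω : Set (EuclideanSpace ℝ (Fin n))}
    {𝒯 : SimplicialDecomposition Ω} {χ : EuclideanSpace ℝ (Fin n) → ℝ} (hχ : χ ∈ 𝒯.lagrangeSpace k)
    (hs : s ∈ 𝒯.elements) : ∃ p ∈ polyFun _ k, Set.EqOn χ p (simplexOf s) := by
  obtain ⟨p, hp, hχp⟩ := hχ.2 s hs
  exact ⟨_, eval_repr_mem_polyFun (EuclideanSpace.basisFun (Fin n) ℝ).toBasis hp, hχp⟩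

namespace SimplicialDecomposition

variable {Ω : Set (EuclideanSpace ℝ (Fin n))} (𝒯 : SimplicialDecomposition Ω)

/-- The vertices of an element, as an affine basis; its coordinates are the barycentric coordinates
on the element. -/
def elementBasis {𝒯 : SimplicialDecomposition Ω} (hs : s ∈ 𝒯.elements) :
    AffineBasis s ℝ (EuclideanSpace ℝ (Fin n)) where
  toFun := (↑)
  ind' := 𝒯.complex.indep hs.1
  tot' := by
    rw [(𝒯.complex.indep hs.1).affineSpan_eq_top_iff_card_eq_finrank_add_one]
    simpa using hs.2

variable {𝒯} in
theorem convexHull_range_elementBasis (hs : s ∈ 𝒯.elements) :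
    convexHull ℝ (Set.range (elementBasis hs)) = simplexOf s :=
  congrArg (convexHull ℝ) Subtype.range_coe

theorem simplexOf_subset_closure (hs : s ∈ 𝒯.elements) : simplexOf s ⊆ closure Ω :=
  𝒯.space_eq ▸ 𝒯.complex.convexHull_subset_space hs.1

theorem finite_elements : 𝒯.elements.Finite :=
  𝒯.finite_faces.subset fun _ hs => hs.1

theorem closure_eq_iUnion : closure Ω = ⋃ s : 𝒯.elements, simplexOf s.1 := by
  refine Set.Subset.antisymm (fun x hx => ?_)
    (Set.iUnion_subset fun s => 𝒯.simplexOf_subset_closure s.2)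
  rw [← 𝒯.space_eq, Geometry.SimplicialComplex.mem_space_iff] at hx
  obtain ⟨s, hs, hxs⟩ := hx
  obtain ⟨t, ht, hst, htc⟩ := 𝒯.pure s hs
  exact Set.mem_iUnion.2 ⟨⟨t, ht, htc⟩, convexHull_mono (Finset.coe_subset.2 hst) hxs⟩

theorem isCompact_closure (𝒯 : SimplicialDecomposition Ω) : IsCompact (closure Ω) := by
  have := 𝒯.finite_elements.to_subtype
  rw [𝒯.closure_eq_iUnion]
  exact isCompact_iUnion fun s => isCompact_simplexOf s.1

theorem simplexDiam_le_diam (hs : s ∈ 𝒯.elements) : simplexDiam s ≤ Metric.diam Ω := by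
  rw [← Metric.diam_closure]
  exact Metric.diam_mono (𝒯.simplexOf_subset_closure hs) 𝒯.isCompact_closure.isBounded

theorem simplexDiam_pos (hn : 1 ≤ n) (hs : s ∈ 𝒯.elements) : 0 < simplexDiam s := by
  obtain ⟨v, hv, w, hw, hvw⟩ := Finset.one_lt_card.1 (show 1 < s.card by rw [hs.2]; omega)
  exact (dist_pos.2 hvw).trans_le (Metric.dist_le_diam_of_mem (isCompact_simplexOf s).isBounded
    (subset_convexHull ℝ _ hv) (subset_convexHull ℝ _ hw))

variable {𝒯} in
theorem lagrangeInterpolation_eqOn_lagrangeNodes (hk : k ≠ 0) (f : EuclideanSpace ℝ (Fin n) → ℝ)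
    (hs : s ∈ 𝒯.elements) :
    Set.EqOn (lagrangeInterpolation (elementBasis hs) k f) f (lagrangeNodes k s) := by
  intro z hz
  obtain ⟨a, ha, rfl⟩ := mem_lagrangeNodes_iff.1 hz
  exact lagrangeInterpolation_lagrangeNode (elementBasis hs) hk f ha

variable {𝒯} in
theorem lagrangeInterpolation_eqOn_inter (hk : k ≠ 0) (f : EuclideanSpace ℝ (Fin n) → ℝ)
    (hs : s ∈ 𝒯.elements) (ht : t ∈ 𝒯.elements) :
    Set.EqOn (lagrangeInterpolation (elementBasis hs) k f)
      (lagrangeInterpolation (elementBasis ht) k f) (simplexOf s ∩ simplexOf t) := by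
  classical
  have hface : simplexOf s ∩ simplexOf t ⊆ simplexOf (s ∩ t) := by
    simpa [simplexOf] using 𝒯.complex.inter_subset_convexHull hs.1 ht.1
  refine (eqOn_simplexOf_of_eqOn_lagrangeNodes hk (lagrangeInterpolation_mem_polyFun _ f)
    (lagrangeInterpolation_mem_polyFun _ f) fun z hz => ?_).mono hface
  rw [lagrangeInterpolation_eqOn_lagrangeNodes hk f hs
      (lagrangeNodes_mono Finset.inter_subset_left hz),
    lagrangeInterpolation_eqOn_lagrangeNodes hk f ht
      (lagrangeNodes_mono Finset.inter_subset_right hz)]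

theorem exists_isLagrangeInterpolant (hk : k ≠ 0) (f : EuclideanSpace ℝ (Fin n) → ℝ) :
    ∃ η, 𝒯.IsLagrangeInterpolant k f η := by
  classical
  let η : EuclideanSpace ℝ (Fin n) → ℝ := fun x =>
    if h : ∃ s, ∃ _ : s ∈ 𝒯.elements, x ∈ simplexOf s then
      lagrangeInterpolation (elementBasis h.choose_spec.choose) k f x
    else 0
  have hη : ∀ s (hs : s ∈ 𝒯.elements),
      Set.EqOn η (lagrangeInterpolation (elementBasis hs) k f) (simplexOf s) := by
    intro s hs x hx
    have h : ∃ s, ∃ _ : s ∈ 𝒯.elements, x ∈ simplexOf s := ⟨s, hs, hx⟩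
    simp only [η, dif_pos h]
    exact lagrangeInterpolation_eqOn_inter hk f _ hs ⟨h.choose_spec.choose_spec, hx⟩
  refine ⟨η, ⟨?_, fun s hs => ?_⟩, fun s hs z hz => ?_⟩
  · have := 𝒯.finite_elements.to_subtype
    rw [𝒯.closure_eq_iUnion]
    refine (locallyFinite_of_finite _).continuousOn_iUnion
      (fun s => (isCompact_simplexOf s.1).isClosed) fun s => ?_
    exact (differentiable_of_mem_polyFun (lagrangeInterpolation_mem_polyFun (elementBasis s.2)
      f)).continuous.continuousOn.congr (hη s.1 s.2)
  · obtain ⟨p, hp, hpe⟩ := exists_mvPolynomial_of_mem_polyFun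
      (EuclideanSpace.basisFun (Fin n) ℝ).toBasis
      (lagrangeInterpolation_mem_polyFun (k := k) (elementBasis hs) f)
    exact ⟨p, hp, fun x hx => (hη s hs hx).trans (hpe x)⟩
  · rw [hη s hs (lagrangeNodes_subset_simplexOf hk hz),
      lagrangeInterpolation_eqOn_lagrangeNodes hk f hs hz]

variable {𝒯} in
theorem IsLagrangeInterpolant.eqOn_lagrangeInterpolation {f g η : EuclideanSpace ℝ (Fin n) → ℝ}
    (hη : 𝒯.IsLagrangeInterpolant k f η) (hk : k ≠ 0) (hs : s ∈ 𝒯.elements)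
    (hfg : Set.EqOn f g (simplexOf s)) :
    Set.EqOn η (lagrangeInterpolation (elementBasis hs) k g) (simplexOf s) := by
  obtain ⟨p, hp, hηp⟩ := exists_mem_polyFun_of_mem_lagrangeSpace hη.1 hs
  refine hηp.trans (eqOn_simplexOf_of_eqOn_lagrangeNodes hk hp
    (lagrangeInterpolation_mem_polyFun _ g) fun z hz => ?_)
  have hzs := lagrangeNodes_subset_simplexOf hk hz
  rw [← hηp hzs, hη.2 s hs z hz, hfg hzs, lagrangeInterpolation_eqOn_lagrangeNodes hk g hs hz]

end SimplicialDecomposition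

end GlobalInterpolation

section LpBounds

variable {X F : Type*} [MeasurableSpace X] [NormedAddCommGroup F] {μ : Measure X} {K L : Set X}
  {v : X → F}

theorem eLpNorm_two_restrict_le_ofReal {M : ℝ} (hK : MeasurableSet K) (hμK : μ K ≠ ∞)
    (hv : ∀ x ∈ K, ‖v x‖ ≤ M) :
    eLpNorm v 2 (μ.restrict K) ≤ ENNReal.ofReal (√(μ.real K) * M) := by
  have h := eLpNorm_le_of_ae_bound (p := 2) ((ae_restrict_iff' hK).2 (ae_of_all μ hv))
  rwa [Measure.restrict_apply_univ, ← ENNReal.ofReal_toReal hμK, ENNReal.toReal_ofNat,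
    ENNReal.ofReal_rpow_of_nonneg ENNReal.toReal_nonneg (by norm_num), ← one_div,
    ← Real.sqrt_eq_rpow, ← ENNReal.ofReal_mul (Real.sqrt_nonneg _)] at h

theorem lpNorm_two_restrict_le {M : ℝ} (hK : MeasurableSet K) (hμK : μ K ≠ ∞) (hM : 0 ≤ M)
    (hv : ∀ x ∈ K, ‖v x‖ ≤ M) : lpNorm v 2 (μ.restrict K) ≤ √(μ.real K) * M := by
  by_cases hvm : AEStronglyMeasurable v (μ.restrict K)
  · rw [← toReal_eLpNorm hvm]
    exact ENNReal.toReal_le_of_le_ofReal (by positivity)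
      (eLpNorm_two_restrict_le_ofReal hK hμK hv)
  · rw [lpNorm_of_not_aestronglyMeasurable hvm]
    positivity

theorem lpNorm_restrict_mono {p : ℝ≥0∞} (hKL : K ⊆ L)
    (hv : MemLp v p (μ.restrict L)) : lpNorm v p (μ.restrict K) ≤ lpNorm v p (μ.restrict L) := by
  have hμ := Measure.restrict_mono hKL (le_refl μ)
  rw [← toReal_eLpNorm hv.1, ← toReal_eLpNorm (hv.mono_measure hμ).1]
  exact ENNReal.toReal_mono hv.eLpNorm_ne_top (eLpNorm_mono_measure v hμ)

end LpBounds

section InverseEstimates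

theorem exists_norm_le_of_injective {V X Y : Type*} [AddCommGroup V] [Module ℝ V]
    [FiniteDimensional ℝ V] [NormedAddCommGroup X] [NormedSpace ℝ X] [NormedAddCommGroup Y]
    [NormedSpace ℝ Y] (F : V →ₗ[ℝ] X) (G : V →ₗ[ℝ] Y) (hF : Function.Injective F) :
    ∃ C : ℝ, ∀ v, ‖G v‖ ≤ C * ‖F v‖ := by
  let e := LinearEquiv.ofInjective F hF
  let L : LinearMap.range F →L[ℝ] Y := LinearMap.toContinuousLinearMap (G ∘ₗ e.symm.toLinearMap)
  have hL (v : V) : L (e v) = G v := by simp [L]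
  exact ⟨‖L‖, fun v => hL v ▸ L.le_opNorm (e v)⟩

variable {E F : Type*} [NormedAddCommGroup E] [NormedSpace ℝ E] [FiniteDimensional ℝ E]
  [MeasurableSpace E] [BorelSpace E] [NormedAddCommGroup F] {μ : Measure E} [μ.IsAddHaarMeasure]
  {K : Set E} {k : ℕ} {ρ : ℝ}

theorem memLp_restrict_of_isBounded {v : E → F} (hv : Continuous v) (hK : Bornology.IsBounded K)
    (p : ℝ≥0∞) : MemLp v p (μ.restrict K) := by
  have hc : IsCompact (closure K) := hK.isCompact_closure
  have : IsFiniteMeasure (μ.restrict (closure K)) := ⟨by simpa using hc.measure_lt_top⟩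
  obtain ⟨M, hM⟩ := hc.exists_bound_of_continuousOn hv.continuousOn
  refine MemLp.mono_measure (Measure.restrict_mono subset_closure le_rfl)
    (.of_bound hv.aestronglyMeasurable M ?_)
  exact (ae_restrict_iff' isClosed_closure.measurableSet).2 (ae_of_all μ hM)

theorem memLp_restrict_of_mem_polyFun {u : E → ℝ} (hu : u ∈ polyFun E k)
    (hK : Bornology.IsBounded K) (p : ℝ≥0∞) : MemLp u p (μ.restrict K) :=
  memLp_restrict_of_isBounded (differentiable_of_mem_polyFun hu).continuous hK p

variable (E k) in
/-- The class in `L²` of the restriction of a polynomial function to a ball. -/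
noncomputable def polyToL2 (μ : Measure E) [μ.IsAddHaarMeasure] (ρ : ℝ) :
    polyFun E k →ₗ[ℝ] Lp ℝ 2 (μ.restrict (Metric.ball 0 ρ)) where
  toFun u := (memLp_restrict_of_mem_polyFun u.2 Metric.isBounded_ball 2).toLp u
  map_add' _ _ := rfl
  map_smul' _ _ := rfl

theorem polyToL2_injective (hρ : 0 < ρ) : Function.Injective (polyToL2 E k μ ρ) := by
  rw [injective_iff_map_eq_zero]
  intro u hu
  have hae : u.1 =ᵐ[μ.restrict (Metric.ball 0 ρ)] 0 :=
    (MemLp.toLp_eq_toLp_iff (memLp_restrict_of_mem_polyFun u.2 Metric.isBounded_ball 2)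
      MemLp.zero).1 hu
  have h0 : Set.EqOn u.1 0 (Metric.ball 0 ρ) := Measure.eqOn_open_of_ae_eq hae Metric.isOpen_ball
    (differentiable_of_mem_polyFun u.2).continuous.continuousOn continuousOn_const
  exact Subtype.ext
    (eq_zero_of_mem_polyFun_of_isOpen u.2 Metric.isOpen_ball (Metric.nonempty_ball.2 hρ) h0)

variable (E k) in
/-- The first-order jets of a polynomial function at the points of the closed unit ball. -/
noncomputable def polyJet :
    polyFun E k →ₗ[ℝ] C(Metric.closedBall (0 : E) 1, ℝ × (E →L[ℝ] ℝ)) where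
  toFun u :=
    { toFun x := (u.1 x, fderiv ℝ u x)
      continuous_toFun :=
        have hu : ContDiff ℝ 1 u.1 := contDiff_of_mem_polyFun u.2
        (hu.continuous.prodMk (hu.continuous_fderiv one_ne_zero)).comp continuous_subtype_val }
  map_add' u v := ContinuousMap.ext fun x => Prod.ext rfl <|
    fderiv_add (differentiable_of_mem_polyFun u.2 x) (differentiable_of_mem_polyFun v.2 x)
  map_smul' c u := ContinuousMap.ext fun x => Prod.ext rfl <|
    fderiv_const_smul (differentiable_of_mem_polyFun u.2 x) c

variable (E k μ) in
theorem exists_norm_jet_le_lpNorm_unit_ball (hρ : 0 < ρ) :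
    ∃ C, ∀ u ∈ polyFun E k, ∀ x ∈ Metric.closedBall (0 : E) 1,
      ‖(u x, fderiv ℝ u x)‖ ≤ C * lpNorm u 2 (μ.restrict (Metric.ball 0 ρ)) := by
  obtain ⟨C, hC⟩ := exists_norm_le_of_injective
    (Y := C(Metric.closedBall (0 : E) 1, ℝ × (E →L[ℝ] ℝ)))
    (polyToL2 E k μ ρ) (polyJet E k) (polyToL2_injective hρ)
  refine ⟨C, fun u hu x hx => ?_⟩
  have hu' := memLp_restrict_of_mem_polyFun (μ := μ) hu (Metric.isBounded_ball (x := 0) (r := ρ)) 2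
  rw [← toReal_eLpNorm hu'.1, ← Lp.norm_toLp u hu']
  exact ((polyJet E k ⟨u, hu⟩).norm_coe_le_norm ⟨x, hx⟩).trans (hC ⟨u, hu⟩)

theorem lpNorm_comp_add_smul {u : E → ℝ} (hu : Continuous u) (x₀ : E) {h : ℝ} (hh : 0 < h)
    (ρ : ℝ) :
    lpNorm (fun z => u (x₀ + h • z)) 2 (μ.restrict (Metric.ball 0 ρ)) =
      √(h ^ Module.finrank ℝ E)⁻¹ * lpNorm u 2 (μ.restrict (Metric.ball x₀ (ρ * h))) := by
  let φ : E → E := fun z => x₀ + h • z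
  have hφ : Measurable φ := by fun_prop
  have hpre : φ ⁻¹' Metric.ball x₀ (ρ * h) = Metric.ball 0 ρ := by
    ext z
    rw [Set.mem_preimage, mem_ball_iff_norm, add_sub_cancel_left, norm_smul, Real.norm_of_nonneg
      hh.le, mul_comm, mul_lt_mul_iff_left₀ hh, mem_ball_zero_iff]
  have hmap : (μ.restrict (Metric.ball 0 ρ)).map φ =
      ENNReal.ofReal (h ^ Module.finrank ℝ E)⁻¹ • μ.restrict (Metric.ball x₀ (ρ * h)) := by
    rw [← hpre, ← Measure.restrict_map hφ measurableSet_ball, ← Measure.restrict_smul,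
      show φ = (x₀ + ·) ∘ (h • ·) from rfl, ← Measure.map_map (by fun_prop) (by fun_prop),
      Measure.map_addHaar_smul _ hh.ne', Measure.map_smul, map_add_left_eq_self,
      abs_of_pos (by positivity)]
  have huφ : AEStronglyMeasurable (fun z => u (x₀ + h • z)) (μ.restrict (Metric.ball 0 ρ)) :=
    (by fun_prop : Continuous fun z => u (x₀ + h • z)).aestronglyMeasurable
  rw [← toReal_eLpNorm huφ,
    ← toReal_eLpNorm hu.aestronglyMeasurable, show (fun z => u (x₀ + h • z)) = u ∘ φ from rfl,
    ← eLpNorm_map_measure hu.aestronglyMeasurable hφ.aemeasurable, hmap,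
    eLpNorm_smul_measure_of_ne_top (by simp), smul_eq_mul, ENNReal.toReal_mul,
    ← ENNReal.toReal_rpow, ENNReal.toReal_ofReal (by positivity), Real.sqrt_eq_rpow]
  simp

theorem sqrt_measureReal_mul_lpNorm_comp_le {u : E → ℝ} (hu : Continuous u) {x₀ : E} {h : ℝ}
    (hh : 0 < h) (hball : Metric.ball x₀ (ρ * h) ⊆ K) (hK : K ⊆ Metric.closedBall x₀ h) :
    √(μ.real K) * lpNorm (fun z => u (x₀ + h • z)) 2 (μ.restrict (Metric.ball 0 ρ)) ≤
      √(μ.real (Metric.closedBall 0 1)) * lpNorm u 2 (μ.restrict K) := by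
  have hμK : μ.real K ≤ h ^ Module.finrank ℝ E * μ.real (Metric.closedBall 0 1) := by
    rw [← Measure.addHaar_real_closedBall' μ x₀ hh.le]
    exact measureReal_mono hK measure_closedBall_lt_top.ne
  have hsqrt : √(μ.real K) * √(h ^ Module.finrank ℝ E)⁻¹ ≤ √(μ.real (Metric.closedBall 0 1)) := by
    rw [← Real.sqrt_mul measureReal_nonneg]
    exact Real.sqrt_le_sqrt ((mul_inv_le_iff₀ (by positivity)).2 (hμK.trans_eq (mul_comm _ _)))
  rw [lpNorm_comp_add_smul hu x₀ hh, ← mul_assoc]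
  exact mul_le_mul hsqrt (lpNorm_restrict_mono hball (memLp_restrict_of_isBounded hu
    (Metric.isBounded_closedBall.subset hK) 2)) lpNorm_nonneg (Real.sqrt_nonneg _)

/-- The inverse estimate on a set `K` of size `h`: polynomial functions of degree at most `k` are
controlled in the (scaled) `C¹` norm by the `L²` norm, with the constant `c`. -/
def HasInverseEstimate {E : Type*} [NormedAddCommGroup E] [NormedSpace ℝ E] [MeasurableSpace E]
    (μ : Measure E) (k : ℕ) (c h : ℝ) (K : Set E) : Prop :=
  ∀ u ∈ polyFun E k, ∀ x ∈ K,
    √(μ.real K) * ‖(u x, h • fderiv ℝ u x)‖ ≤ c * lpNorm u 2 (μ.restrict K)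

variable (E k μ) in
theorem exists_hasInverseEstimate (hρ : 0 < ρ) :
    ∃ c, 0 < c ∧ ∀ (x₀ : E) (h : ℝ), 0 < h → ∀ K : Set E, Metric.ball x₀ (ρ * h) ⊆ K →
      K ⊆ Metric.closedBall x₀ h → HasInverseEstimate μ k c h K := by
  obtain ⟨C, hC⟩ := exists_norm_jet_le_lpNorm_unit_ball E μ k hρ
  let c := max C 1 * √(μ.real (Metric.closedBall 0 1))
  have hc : 0 < c := mul_pos (by positivity)
    (Real.sqrt_pos.2 (ENNReal.toReal_pos
      (Metric.measure_closedBall_pos _ _ one_pos).ne' measure_closedBall_lt_top.ne))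
  refine ⟨c, hc, fun x₀ h hh K hball hK u hu x hx => ?_⟩
  let v : E → ℝ := fun z => u (x₀ + h • z)
  let z := h⁻¹ • (x - x₀)
  have hz : x₀ + h • z = x := by simp [z, smul_smul, hh.ne']
  have hz1 : z ∈ Metric.closedBall 0 1 := by
    rw [mem_closedBall_zero_iff, norm_smul, norm_inv, Real.norm_of_nonneg hh.le,
      inv_mul_le_iff₀ hh, mul_one]
    exact mem_closedBall_iff_norm.1 (hK hx)
  have hv : v ∈ polyFun E k :=
    comp_affineMap_mem_polyFun hu (AffineMap.const ℝ E x₀ + h • AffineMap.id ℝ E)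
  have hjet : (v z, fderiv ℝ v z) = (u x, h • fderiv ℝ u x) := by
    rw [fderiv_comp_smul (f := fun y => u (x₀ + y)), fderiv_comp_add_left, hz]
    simp only [v, hz]
  calc √(μ.real K) * ‖(u x, h • fderiv ℝ u x)‖
      ≤ √(μ.real K) * (max C 1 * lpNorm v 2 (μ.restrict (Metric.ball 0 ρ))) := by
        rw [← hjet]
        gcongr
        exact (hC v hv z hz1).trans (by gcongr; exacts [lpNorm_nonneg, le_max_left C 1])
    _ = max C 1 * (√(μ.real K) * lpNorm v 2 (μ.restrict (Metric.ball 0 ρ))) := by ring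
    _ ≤ max C 1 * (√(μ.real (Metric.closedBall 0 1)) * lpNorm u 2 (μ.restrict K)) :=
        mul_le_mul_of_nonneg_left (sqrt_measureReal_mul_lpNorm_comp_le
          (differentiable_of_mem_polyFun hu).continuous hh hball hK) (by positivity)
    _ = c * lpNorm u 2 (μ.restrict K) := (mul_assoc _ _ _).symm

end InverseEstimates

section LocalApproximation

theorem norm_image_sub_le_of_norm_fderiv_interior_le {E F : Type*} [NormedAddCommGroup E]
    [NormedSpace ℝ E] [NormedAddCommGroup F] [NormedSpace ℝ F] {S : Set E} {g : E → F} {M : ℝ}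
    {x₀ x : E} (hS : Convex ℝ S) (hg : ContinuousOn g S)
    (hgd : ∀ y ∈ interior S, DifferentiableAt ℝ g y) (hgM : ∀ y ∈ interior S, ‖fderiv ℝ g y‖ ≤ M)
    (hx₀ : x₀ ∈ interior S) (hx : x ∈ S) : ‖g x - g x₀‖ ≤ M * ‖x - x₀‖ := by
  have hx' : x ∈ closure (interior S) :=
    hS.closure_interior_eq_closure_of_nonempty_interior ⟨x₀, hx₀⟩ ▸ subset_closure hx
  have : (nhdsWithin x (interior S)).NeBot := mem_closure_iff_nhdsWithin_neBot.1 hx'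
  have hgx : Filter.Tendsto g (nhdsWithin x (interior S)) (nhds (g x)) :=
    (hg x hx).mono interior_subset
  have hle : ∀ y ∈ interior S, ‖g y - g x₀‖ ≤ M * ‖y - x₀‖ := fun y hy =>
    hS.interior.norm_image_sub_le_of_norm_fderiv_le hgd hgM hx₀ hy
  exact le_of_tendsto_of_tendsto (hgx.sub_const _).norm
    (((continuous_id.sub continuous_const).norm.const_mul M).continuousWithinAt)
    (Filter.eventually_of_mem self_mem_nhdsWithin hle)

/-- `ω` is a `C²` function on `K` which varies on the length scale `d`:
`|Dʲω| ≤ B d⁻ʲ` on `K` for `j ≤ 2`. -/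
structure IsCutoffOn {E : Type*} [NormedAddCommGroup E] [NormedSpace ℝ E] (ω : E → ℝ) (B d : ℝ)
    (K : Set E) : Prop where
  contDiffOn : ContDiffOn ℝ 2 ω K
  abs_le : ∀ x ∈ K, |ω x| ≤ B
  norm_fderiv_le : ∀ x ∈ K, ‖fderiv ℝ ω x‖ ≤ B / d
  norm_fderiv_fderiv_le : ∀ x ∈ K, ‖fderiv ℝ (fderiv ℝ ω) x‖ ≤ B / d ^ 2

/-- The polynomial approximation of `ω² p` near `x₀`. Its gradient at `x₀` is that of `ω² p`, but
its leading part `ω(x₀)² p` is kept unexpanded, since derivatives of `p` of order two and higher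
are not controlled. -/
noncomputable def localApprox {E : Type*} [NormedAddCommGroup E] [NormedSpace ℝ E] (ω p : E → ℝ)
    (x₀ : E) : E → ℝ :=
  fun x => ω x₀ ^ 2 * p x + 2 * ω x₀ * p x₀ * fderiv ℝ ω x₀ (x - x₀)

variable {E : Type*} [NormedAddCommGroup E] [NormedSpace ℝ E] {K : Set E} {ω p : E → ℝ}
  {B d h P G : ℝ} {x₀ x : E}

namespace IsCutoffOn

theorem mono (hω : IsCutoffOn ω B d K) {L : Set E} (hL : L ⊆ K) : IsCutoffOn ω B d L where
  contDiffOn := hω.contDiffOn.mono hL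
  abs_le x hx := hω.abs_le x (hL hx)
  norm_fderiv_le x hx := hω.norm_fderiv_le x (hL hx)
  norm_fderiv_fderiv_le x hx := hω.norm_fderiv_fderiv_le x (hL hx)

theorem differentiableAt (hω : IsCutoffOn ω B d K) (hK : IsOpen K) (hx : x ∈ K) :
    DifferentiableAt ℝ ω x :=
  (hω.contDiffOn.contDiffAt (hK.mem_nhds hx)).differentiableAt two_ne_zero

theorem bound_nonneg (hω : IsCutoffOn ω B d K) (hx : x ∈ K) : 0 ≤ B :=
  (abs_nonneg _).trans (hω.abs_le x hx)

theorem abs_sub_le (hω : IsCutoffOn ω B d K) (hK : IsOpen K) (hKc : Convex ℝ K) (hd : 0 < d)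
    (hx₀ : x₀ ∈ K) (hx : x ∈ K) (hxh : ‖x - x₀‖ ≤ h) : |ω x - ω x₀| ≤ B / d * h := by
  have hB := hω.bound_nonneg hx
  exact (hKc.norm_image_sub_le_of_norm_fderiv_le (fun y hy => hω.differentiableAt hK hy)
    hω.norm_fderiv_le hx₀ hx).trans (by gcongr)

theorem norm_fderiv_sub_le (hω : IsCutoffOn ω B d K) (hK : IsOpen K) (hKc : Convex ℝ K)
    (hx₀ : x₀ ∈ K) (hx : x ∈ K) (hxh : ‖x - x₀‖ ≤ h) :
    ‖fderiv ℝ ω x - fderiv ℝ ω x₀‖ ≤ B / d ^ 2 * h := by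
  have hB := hω.bound_nonneg hx
  have hdiff : ∀ y ∈ K, DifferentiableAt ℝ (fderiv ℝ ω) y := fun y hy =>
    ((hω.contDiffOn.contDiffAt (hK.mem_nhds hy)).fderiv_right (m := 1) le_rfl).differentiableAt
      one_ne_zero
  exact (hKc.norm_image_sub_le_of_norm_fderiv_le hdiff hω.norm_fderiv_fderiv_le hx₀ hx).trans
    (by gcongr)

theorem norm_smul_fderiv_sub_le (hω : IsCutoffOn ω B d K) (hK : IsOpen K) (hKc : Convex ℝ K)
    (hd : 0 < d) (hx₀ : x₀ ∈ K) (hx : x ∈ K) (hxh : ‖x - x₀‖ ≤ h) :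
    ‖ω x • fderiv ℝ ω x - ω x₀ • fderiv ℝ ω x₀‖ ≤ 2 * B ^ 2 / d ^ 2 * h := by
  have hB := hω.bound_nonneg hx
  have hh : 0 ≤ h := (norm_nonneg _).trans hxh
  have hsplit : ω x • fderiv ℝ ω x - ω x₀ • fderiv ℝ ω x₀ =
      (ω x - ω x₀) • fderiv ℝ ω x + ω x₀ • (fderiv ℝ ω x - fderiv ℝ ω x₀) := by module
  calc ‖ω x • fderiv ℝ ω x - ω x₀ • fderiv ℝ ω x₀‖
      ≤ |ω x - ω x₀| * ‖fderiv ℝ ω x‖ + |ω x₀| * ‖fderiv ℝ ω x - fderiv ℝ ω x₀‖ := by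
        rw [hsplit, ← Real.norm_eq_abs, ← Real.norm_eq_abs, ← norm_smul, ← norm_smul]
        exact norm_add_le _ _
    _ ≤ B / d * h * (B / d) + B * (B / d ^ 2 * h) := by
        gcongr
        exacts [hω.abs_sub_le hK hKc hd hx₀ hx hxh, hω.norm_fderiv_le x hx, hω.abs_le x₀ hx₀,
          hω.norm_fderiv_sub_le hK hKc hx₀ hx hxh]
    _ = 2 * B ^ 2 / d ^ 2 * h := by field

theorem abs_sq_sub_sq_mul_le (hω : IsCutoffOn ω B d K) (hK : IsOpen K) (hKc : Convex ℝ K)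
    (hd : 0 < d) (hx₀ : x₀ ∈ K) (hx : x ∈ K) (hxh : ‖x - x₀‖ ≤ h) {t : ℝ} (ht : 0 ≤ t)
    (htG : |ω x₀| * t ≤ G) (htP : h * t ≤ P) :
    |ω x ^ 2 - ω x₀ ^ 2| * t ≤ B / d * h * (2 * G + B / d * P) := by
  have hB := hω.bound_nonneg hx
  have hh : 0 ≤ h := (norm_nonneg _).trans hxh
  have hsub := hω.abs_sub_le hK hKc hd hx₀ hx hxh
  have hadd : |ω x + ω x₀| ≤ 2 * |ω x₀| + B / d * h := by
    calc |ω x + ω x₀| = |2 * ω x₀ + (ω x - ω x₀)| := by ring_nf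
      _ ≤ |2 * ω x₀| + |ω x - ω x₀| := abs_add_le _ _
      _ ≤ 2 * |ω x₀| + B / d * h := by rw [abs_mul, abs_two]; gcongr
  calc |ω x ^ 2 - ω x₀ ^ 2| * t = |ω x - ω x₀| * (|ω x + ω x₀| * t) := by
        rw [sq_sub_sq, abs_mul]; ring
    _ ≤ B / d * h * ((2 * |ω x₀| + B / d * h) * t) := by gcongr
    _ = B / d * h * (2 * (|ω x₀| * t) + B / d * (h * t)) := by ring
    _ ≤ B / d * h * (2 * G + B / d * P) := by gcongr

theorem abs_mul_sub_le (hω : IsCutoffOn ω B d K) (hK : IsOpen K) (hKc : Convex ℝ K) (hd : 0 < d)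
    (hx₀ : x₀ ∈ K) (hx : x ∈ K) (hxh : ‖x - x₀‖ ≤ h) (hp : Differentiable ℝ p)
    (hpG : ∀ y ∈ K, |ω x₀| * ‖fderiv ℝ p y‖ ≤ G) (hpP : ∀ y ∈ K, h * ‖fderiv ℝ p y‖ ≤ P) :
    |ω x| * |p x - p x₀| ≤ h * (G + B / d * P) := by
  have hB := hω.bound_nonneg hx
  have hh : 0 ≤ h := (norm_nonneg _).trans hxh
  have hmean {a M : ℝ} (ha : 0 ≤ a) (hM : ∀ y ∈ K, a * ‖fderiv ℝ p y‖ ≤ M) :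
      a * |p x - p x₀| ≤ M * h := by
    have hM0 : 0 ≤ M := (by positivity : 0 ≤ a * ‖fderiv ℝ p x‖).trans (hM x hx)
    have := hKc.norm_image_sub_le_of_norm_fderiv_le (𝕜 := ℝ) (f := fun y => a * p y)
      (fun y _ => (hp y).const_mul a) (fun y hy => by
        rw [fderiv_const_mul (hp y), norm_smul, Real.norm_of_nonneg ha]
        exact hM y hy) hx₀ hx
    rw [← mul_sub, norm_mul, Real.norm_of_nonneg ha, Real.norm_eq_abs] at this
    exact this.trans (by gcongr)
  calc |ω x| * |p x - p x₀|
      ≤ (|ω x₀| + |ω x - ω x₀|) * |p x - p x₀| := by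
        gcongr
        linarith [abs_sub_abs_le_abs_sub (ω x) (ω x₀)]
    _ ≤ (|ω x₀| + B / d * h) * |p x - p x₀| := by
        gcongr
        exact hω.abs_sub_le hK hKc hd hx₀ hx hxh
    _ = |ω x₀| * |p x - p x₀| + B / d * (h * |p x - p x₀|) := by ring
    _ ≤ G * h + B / d * (P * h) := by
        gcongr ?_ + _ * ?_
        exacts [hmean (abs_nonneg _) hpG, hmean hh hpP]
    _ = h * (G + B / d * P) := by ring

theorem norm_fderiv_mul_sub_le (hω : IsCutoffOn ω B d K) (hK : IsOpen K)
    (hKc : Convex ℝ K) (hd : 0 < d) (hx₀ : x₀ ∈ K) (hx : x ∈ K) (hxh : ‖x - x₀‖ ≤ h)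
    (hp : DifferentiableAt ℝ p x) (hpP : |p x| ≤ P) (hpP' : h * ‖fderiv ℝ p x‖ ≤ P) :
    ‖fderiv ℝ (fun y => ω y * p y) x - ω x₀ • fderiv ℝ p x‖ ≤ 2 * (B / d) * P := by
  have hB := hω.bound_nonneg hx
  have hsplit : fderiv ℝ (fun y => ω y * p y) x - ω x₀ • fderiv ℝ p x =
      (ω x - ω x₀) • fderiv ℝ p x + p x • fderiv ℝ ω x := by
    rw [fderiv_fun_mul (hω.differentiableAt hK hx) hp]
    module
  calc ‖fderiv ℝ (fun y => ω y * p y) x - ω x₀ • fderiv ℝ p x‖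
      ≤ |ω x - ω x₀| * ‖fderiv ℝ p x‖ + |p x| * ‖fderiv ℝ ω x‖ := by
        rw [hsplit, ← Real.norm_eq_abs, ← Real.norm_eq_abs, ← norm_smul, ← norm_smul]
        exact norm_add_le _ _
    _ ≤ B / d * h * ‖fderiv ℝ p x‖ + P * (B / d) := by
        gcongr
        exacts [hω.abs_sub_le hK hKc hd hx₀ hx hxh, (abs_nonneg _).trans hpP,
          hω.norm_fderiv_le x hx]
    _ = B / d * (h * ‖fderiv ℝ p x‖) + P * (B / d) := by ring
    _ ≤ B / d * P + P * (B / d) := by gcongr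
    _ = 2 * (B / d) * P := by ring

end IsCutoffOn

theorem localApprox_self (ω p : E → ℝ) (x₀ : E) : localApprox ω p x₀ x₀ = ω x₀ ^ 2 * p x₀ := by
  simp [localApprox]

theorem localApprox_mem_polyFun [FiniteDimensional ℝ E] {k : ℕ} (hk : k ≠ 0) (ω : E → ℝ)
    (hp : p ∈ polyFun E k) (x₀ : E) : localApprox ω p x₀ ∈ polyFun E k := by
  have hlin : (fun x => fderiv ℝ ω x₀ (x - x₀)) ∈ polyFun E k :=
    polyFun_mono (Nat.one_le_iff_ne_zero.2 hk) <| affineMap_mem_polyFun <|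
      (fderiv ℝ ω x₀).toLinearMap.toAffineMap.comp (AffineMap.id ℝ E - AffineMap.const ℝ E x₀)
  exact add_mem ((polyFun E k).smul_mem _ hp) ((polyFun E k).smul_mem _ hlin)

theorem hasFDerivAt_sq_mul_sub_localApprox (hω : DifferentiableAt ℝ ω x)
    (hp : DifferentiableAt ℝ p x) (x₀ : E) :
    HasFDerivAt (fun y => ω y ^ 2 * p y - localApprox ω p x₀ y)
      ((2 * (ω x * (p x - p x₀))) • fderiv ℝ ω x + (ω x ^ 2 - ω x₀ ^ 2) • fderiv ℝ p x +
        (2 * p x₀) • (ω x • fderiv ℝ ω x - ω x₀ • fderiv ℝ ω x₀)) x := by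
  have happrox : HasFDerivAt (localApprox ω p x₀)
      (ω x₀ ^ 2 • fderiv ℝ p x + (2 * ω x₀ * p x₀) • fderiv ℝ ω x₀) x :=
    (hp.hasFDerivAt.const_mul _).add
      (((fderiv ℝ ω x₀).hasFDerivAt.comp x ((hasFDerivAt_id x).sub_const x₀)).const_mul _)
  refine (((hω.hasFDerivAt.pow 2).mul hp.hasFDerivAt).sub happrox).congr_fderiv ?_
  ext y
  simp only [add_apply, sub_apply, smul_apply, smul_eq_mul]
  ring

theorem norm_fderiv_sq_mul_sub_localApprox_le (hω : IsCutoffOn ω B d K) (hK : IsOpen K)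
    (hKc : Convex ℝ K) (hd : 0 < d) (hx₀ : x₀ ∈ K) (hx : x ∈ K) (hxh : ‖x - x₀‖ ≤ h)
    (hp : Differentiable ℝ p) (hp₀ : |p x₀| ≤ P) (hpP : ∀ y ∈ K, h * ‖fderiv ℝ p y‖ ≤ P)
    (hpG : ∀ y ∈ K, |ω x₀| * ‖fderiv ℝ p y‖ ≤ G) :
    ‖fderiv ℝ (fun y => ω y ^ 2 * p y - localApprox ω p x₀ y) x‖ ≤
      4 * B * (h / d) * G + 7 * B ^ 2 * (h / d ^ 2) * P := by
  have hP : 0 ≤ P := (abs_nonneg _).trans hp₀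
  have hG : 0 ≤ G := (by positivity : 0 ≤ |ω x₀| * ‖fderiv ℝ p x‖).trans (hpG x hx)
  have hh : 0 ≤ h := (norm_nonneg _).trans hxh
  have hB := hω.bound_nonneg hx
  rw [(hasFDerivAt_sq_mul_sub_localApprox (hω.differentiableAt hK hx) (hp x) x₀).fderiv]
  calc _ ≤ 2 * (|ω x| * |p x - p x₀|) * ‖fderiv ℝ ω x‖ + |ω x ^ 2 - ω x₀ ^ 2| * ‖fderiv ℝ p x‖ +
        2 * |p x₀| * ‖ω x • fderiv ℝ ω x - ω x₀ • fderiv ℝ ω x₀‖ := by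
        refine norm_add₃_le.trans_eq ?_
        simp only [norm_smul, Real.norm_eq_abs, abs_mul, abs_two]
    _ ≤ 2 * (h * (G + B / d * P)) * (B / d) + B / d * h * (2 * G + B / d * P) +
        2 * P * (2 * B ^ 2 / d ^ 2 * h) := by
        gcongr 2 * ?_ * ?_ + ?_ + 2 * ?_ * ?_
        exacts [hω.abs_mul_sub_le hK hKc hd hx₀ hx hxh hp hpG hpP, hω.norm_fderiv_le x hx,
          hω.abs_sq_sub_sq_mul_le hK hKc hd hx₀ hx hxh (norm_nonneg _) (hpG x hx) (hpP x hx),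
          hω.norm_smul_fderiv_sub_le hK hKc hd hx₀ hx hxh]
    _ = 4 * B * (h / d) * G + 7 * B ^ 2 * (h / d ^ 2) * P := by
        field_simp
        ring

end LocalApproximation

section Seminorms

variable {n : ℕ} {U : Set (EuclideanSpace ℝ (Fin n))} {u v : EuclideanSpace ℝ (Fin n) → ℝ}

theorem opNorm_le_of_norm_apply_single_le {F : Type*} [NormedAddCommGroup F]
    [NormedSpace ℝ F] (L : EuclideanSpace ℝ (Fin n) →L[ℝ] F) {a : ℝ} (ha : 0 ≤ a)
    (h : ∀ i, ‖L (EuclideanSpace.single i 1)‖ ≤ a) : ‖L‖ ≤ n * a := by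
  refine L.opNorm_le_bound (by positivity) fun x => ?_
  calc ‖L x‖ = ‖∑ i, x i • L (EuclideanSpace.single i 1)‖ := by
        conv_lhs => rw [← (EuclideanSpace.basisFun (Fin n) ℝ).sum_repr x]
        simp
    _ ≤ ∑ i, ‖x i • L (EuclideanSpace.single i 1)‖ := norm_sum_le _ _
    _ ≤ ∑ _i : Fin n, ‖x‖ * a := Finset.sum_le_sum fun i _ => by
        rw [norm_smul]
        exact mul_le_mul (PiLp.norm_apply_le x i) (h i) (norm_nonneg _) (norm_nonneg _)
    _ = n * a * ‖x‖ := by simp; ring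

theorem norm_le_of_ae_norm_le {X F : Type*} [TopologicalSpace X] [MeasurableSpace X]
    {μ : Measure X} [μ.IsOpenPosMeasure] [NormedAddCommGroup F] {U : Set X} (hU : IsOpen U)
    {g : X → F} (hg : ContinuousOn g U) {a : ℝ} (h : ∀ᵐ y ∂μ.restrict U, ‖g y‖ ≤ a) {x : X}
    (hx : x ∈ U) : ‖g x‖ ≤ a := by
  have hmin : (fun y => min ‖g y‖ a) =ᵐ[μ.restrict U] fun y => ‖g y‖ :=
    h.mono fun y hy => min_eq_left hy
  exact min_eq_left_iff.1
    (Measure.eqOn_open_of_ae_eq hmin hU (hg.norm.inf continuousOn_const) hg.norm hx)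

theorem norm_iteratedFDeriv_single_le (hU : IsOpen U) {j : ℕ} (hu : ContDiffOn ℝ j u U) {a : ℝ}
    (ha : 0 ≤ a) (h : wInftySeminorm j u U ≤ ENNReal.ofReal a) (i : Fin j → Fin n)
    {x : EuclideanSpace ℝ (Fin n)} (hx : x ∈ U) :
    ‖iteratedFDeriv ℝ j u x fun l => EuclideanSpace.single (i l) (1 : ℝ)‖ ≤ a := by
  let g : EuclideanSpace ℝ (Fin n) → ℝ := fun x =>
    iteratedFDeriv ℝ j u x fun l => EuclideanSpace.single (i l) (1 : ℝ)
  have hg : ContinuousOn g U := fun y hy =>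
    (((hu.continuousOn_iteratedFDerivWithin le_rfl hU.uniqueDiffOn).congr fun z hz =>
      (iteratedFDerivWithin_of_isOpen j hU hz).symm) y hy).eval_const _
  have hae : ∀ᵐ y ∂volume.restrict U, ‖g y‖ ≤ a := by
    have hga : eLpNormEssSup g (volume.restrict U) ≤ ENNReal.ofReal a :=
      eLpNorm_exponent_top (f := g) ▸ (le_iSup (fun i : Fin j → Fin n => eLpNorm (fun x =>
        iteratedFDeriv ℝ j u x fun l => EuclideanSpace.single (i l) (1 : ℝ)) ⊤ _) i).trans h
    filter_upwards [enorm_ae_le_eLpNormEssSup g (volume.restrict U)] with y hy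
    rw [← ENNReal.ofReal_le_ofReal_iff ha, ofReal_norm]
    exact hy.trans hga
  exact norm_le_of_ae_norm_le hU hg hae hx

theorem isCutoffOn_of_wInftySeminorm_le (hn : 1 ≤ n) (hU : IsOpen U) (hu : ContDiffOn ℝ 2 u U)
    {A d : ℝ} (hA : 0 ≤ A) (hd : 0 < d)
    (h : ∀ j ≤ 2, wInftySeminorm j u U ≤ ENNReal.ofReal (A * (d ^ j)⁻¹)) :
    IsCutoffOn u (n ^ 2 * A) d U := by
  have hn' : (1 : ℝ) ≤ n := by exact_mod_cast hn
  have hD {x} (hx : x ∈ U) (j : ℕ) (hj : j ≤ 2) (i : Fin j → Fin n) :=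
    norm_iteratedFDeriv_single_le hU (hu.of_le (by exact_mod_cast hj)) (by positivity) (h j hj) i hx
  refine ⟨hu, fun x hx => ?_, fun x hx => ?_, fun x hx => ?_⟩
  · have h0 := hD hx 0 (by norm_num) Fin.elim0
    rw [iteratedFDeriv_zero_apply, pow_zero, inv_one, mul_one] at h0
    exact h0.trans (le_mul_of_one_le_left hA (one_le_pow₀ hn'))
  · have h1 : ‖fderiv ℝ u x‖ ≤ n * (A * (d ^ 1)⁻¹) :=
      opNorm_le_of_norm_apply_single_le _ (by positivity) fun i => by
        simpa only [iteratedFDeriv_one_apply] using hD hx 1 (by norm_num) fun _ => i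
    calc ‖fderiv ℝ u x‖ ≤ n * (A * (d ^ 1)⁻¹) := h1
      _ ≤ n ^ 2 * (A * (d ^ 1)⁻¹) := by gcongr; exact le_self_pow₀ hn' two_ne_zero
      _ = n ^ 2 * A / d := by rw [pow_one, ← mul_assoc, ← div_eq_mul_inv]
  · have h2 : ‖fderiv ℝ (fderiv ℝ u) x‖ ≤ n * (n * (A * (d ^ 2)⁻¹)) :=
      opNorm_le_of_norm_apply_single_le _ (by positivity) fun i =>
        opNorm_le_of_norm_apply_single_le _ (by positivity) fun j => by
          simpa only [iteratedFDeriv_two_apply, Matrix.cons_val_zero, Matrix.cons_val_one] using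
            hD hx 2 le_rfl ![i, j]
    exact h2.trans_eq (by ring)

theorem gradL2Norm_eq_eLpNorm_fderiv (u : EuclideanSpace ℝ (Fin n) → ℝ)
    (U : Set (EuclideanSpace ℝ (Fin n))) :
    gradL2Norm u U = eLpNorm (fderiv ℝ u) 2 (volume.restrict U) :=
  eLpNorm_congr_norm_ae (ae_of_all _ fun x => by simp [gradient])

theorem l2Norm_congr (hU : IsOpen U) (h : Set.EqOn u v U) : l2Norm u U = l2Norm v U :=
  eLpNorm_congr_ae ((ae_restrict_iff' hU.measurableSet).2 (ae_of_all _ h))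

theorem gradL2Norm_congr (hU : IsOpen U) (h : Set.EqOn u v U) :
    gradL2Norm u U = gradL2Norm v U := by
  rw [gradL2Norm_eq_eLpNorm_fderiv, gradL2Norm_eq_eLpNorm_fderiv]
  exact eLpNorm_congr_ae ((ae_restrict_iff' hU.measurableSet).2 (ae_of_all _ fun x hx =>
    (Filter.eventuallyEq_of_mem (hU.mem_nhds hx) h).fderiv_eq))

theorem h1Norm_congr (hU : IsOpen U) (h : Set.EqOn u v U) : h1Norm u U = h1Norm v U := by
  rw [h1Norm, h1Norm, l2Norm_congr hU h, gradL2Norm_congr hU h]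

theorem h1Norm_le_add (u : EuclideanSpace ℝ (Fin n) → ℝ) (U : Set (EuclideanSpace ℝ (Fin n))) :
    h1Norm u U ≤ l2Norm u U + gradL2Norm u U := by
  have hsq : l2Norm u U ^ 2 + gradL2Norm u U ^ 2 ≤ (l2Norm u U + gradL2Norm u U) ^ 2 := by
    rw [add_sq, add_right_comm]
    exact le_self_add
  calc h1Norm u U ≤ ((l2Norm u U + gradL2Norm u U) ^ 2) ^ (1 / 2 : ℝ) := by
        rw [h1Norm]
        gcongr
    _ = l2Norm u U + gradL2Norm u U := by
        rw [← ENNReal.rpow_natCast, ← ENNReal.rpow_mul]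
        norm_num

end Seminorms

section ElementEstimate

variable {E : Type*} [NormedAddCommGroup E] [NormedSpace ℝ E] [MeasurableSpace E] {μ : Measure E}
  {K : Set E} {k : ℕ} {c h B d M : ℝ} {ω p u : E → ℝ} {x₀ x : E}

namespace HasInverseEstimate

theorem sqrt_mul_abs_le (hinv : HasInverseEstimate μ k c h K) (hu : u ∈ polyFun E k)
    (hx : x ∈ K) : √(μ.real K) * |u x| ≤ c * lpNorm u 2 (μ.restrict K) :=
  (mul_le_mul_of_nonneg_left (norm_fst_le (u x, h • fderiv ℝ u x)) (Real.sqrt_nonneg _)).trans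
    (hinv u hu x hx)

theorem sqrt_mul_norm_fderiv_le (hinv : HasInverseEstimate μ k c h K) (hh : 0 ≤ h)
    (hu : u ∈ polyFun E k) (hx : x ∈ K) :
    √(μ.real K) * (h * ‖fderiv ℝ u x‖) ≤ c * lpNorm u 2 (μ.restrict K) := by
  have hle : h * ‖fderiv ℝ u x‖ ≤ ‖(u x, h • fderiv ℝ u x)‖ := by
    simpa only [norm_smul, Real.norm_of_nonneg hh] using norm_snd_le (u x, h • fderiv ℝ u x)
  exact (mul_le_mul_of_nonneg_left hle (Real.sqrt_nonneg _)).trans (hinv u hu x hx)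

theorem mul_norm_fderiv_le_of_abs_le (hinv : HasInverseEstimate μ k c h K) (hc : 0 ≤ c)
    (hh : 0 ≤ h) (hK : MeasurableSet K) (hμK : 0 < μ.real K) (hu : u ∈ polyFun E k)
    (hM : ∀ y ∈ K, |u y| ≤ M) (hx : x ∈ K) : h * ‖fderiv ℝ u x‖ ≤ c * M := by
  have hM0 : 0 ≤ M := (abs_nonneg _).trans (hM x hx)
  have hL2 : lpNorm u 2 (μ.restrict K) ≤ √(μ.real K) * M :=
    lpNorm_two_restrict_le hK (ENNReal.toReal_pos_iff.1 hμK).2.ne hM0 hM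
  refine le_of_mul_le_mul_left ?_ (Real.sqrt_pos.2 hμK)
  calc √(μ.real K) * (h * ‖fderiv ℝ u x‖) ≤ c * lpNorm u 2 (μ.restrict K) :=
        hinv.sqrt_mul_norm_fderiv_le hh hu hx
    _ ≤ c * (√(μ.real K) * M) := by gcongr
    _ = √(μ.real K) * (c * M) := by ring

variable [BorelSpace E] [FiniteDimensional ℝ E] [μ.IsAddHaarMeasure]

theorem sqrt_mul_norm_fderiv_le_lpNorm_fderiv (hinv : HasInverseEstimate μ k c h K) (hc : 0 ≤ c)
    (hK : Bornology.IsBounded K) (hu : u ∈ polyFun E k) (hx : x ∈ K) :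
    √(μ.real K) * ‖fderiv ℝ u x‖ ≤ c * lpNorm (fderiv ℝ u) 2 (μ.restrict K) := by
  have hu' : MemLp (fderiv ℝ u) 2 (μ.restrict K) := memLp_restrict_of_isBounded
    ((contDiff_of_mem_polyFun hu).continuous_fderiv one_ne_zero) hK 2
  rw [← Real.norm_of_nonneg (Real.sqrt_nonneg (μ.real K)), ← norm_smul]
  refine ContinuousLinearMap.opNorm_le_bound _ (mul_nonneg hc lpNorm_nonneg) fun e => ?_
  have he : lpNorm (fun y => fderiv ℝ u y e) 2 (μ.restrict K) ≤
      lpNorm (‖e‖ • fun y => ‖fderiv ℝ u y‖) 2 (μ.restrict K) :=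
    lpNorm_mono_real (hu'.norm.const_smul ‖e‖) fun y =>
      ((fderiv ℝ u y).le_opNorm e).trans_eq (mul_comm _ _)
  calc ‖(√(μ.real K) • fderiv ℝ u x) e‖ = √(μ.real K) * |fderiv ℝ u x e| := by
        rw [smul_apply, norm_smul, Real.norm_of_nonneg (Real.sqrt_nonneg _), Real.norm_eq_abs]
    _ ≤ c * lpNorm (fun y => fderiv ℝ u y e) 2 (μ.restrict K) :=
        hinv.sqrt_mul_abs_le (fderiv_apply_mem_polyFun hu e) hx
    _ ≤ c * lpNorm (‖e‖ • fun y => ‖fderiv ℝ u y‖) 2 (μ.restrict K) := by gcongr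
    _ = c * lpNorm (fderiv ℝ u) 2 (μ.restrict K) * ‖e‖ := by
        rw [lpNorm_const_smul, lpNorm_norm hu'.1, coe_nnnorm, norm_norm]
        ring

end HasInverseEstimate

section CutoffGradient

variable [BorelSpace E] [FiniteDimensional ℝ E] [μ.IsAddHaarMeasure]

theorem IsCutoffOn.memLp_fderiv_mul (hω : IsCutoffOn ω B d K) (hK : IsOpen K)
    (hKb : Bornology.IsBounded K) (hp : p ∈ polyFun E k) :
    MemLp (fderiv ℝ fun x => ω x * p x) 2 (μ.restrict K) := by
  have hp1 : ContDiff ℝ 1 p := contDiff_of_mem_polyFun hp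
  have hmeas : AEStronglyMeasurable (fderiv ℝ fun x => ω x * p x) (μ.restrict K) :=
    (((hω.contDiffOn.of_le one_le_two).mul hp1.contDiffOn).continuousOn_fderiv_of_isOpen hK
      le_rfl).aestronglyMeasurable hK.measurableSet
  have hmaj : Continuous fun x => B * ‖fderiv ℝ p x‖ + |p x| * (B / d) :=
    ((hp1.continuous_fderiv one_ne_zero).norm.const_mul B).add
      (hp1.continuous.abs.mul continuous_const)
  refine (memLp_restrict_of_isBounded hmaj hKb 2).mono' hmeas
    ((ae_restrict_iff' hK.measurableSet).2 (ae_of_all μ fun x hx => ?_))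
  rw [fderiv_fun_mul (hω.differentiableAt hK hx) (differentiable_of_mem_polyFun hp x)]
  refine (norm_add_le _ _).trans ?_
  rw [norm_smul, norm_smul, Real.norm_eq_abs, Real.norm_eq_abs]
  gcongr
  exacts [hω.abs_le x hx, hω.norm_fderiv_le x hx]

theorem HasInverseEstimate.sqrt_mul_abs_mul_norm_fderiv_le (hinv : HasInverseEstimate μ k c h K)
    (hc : 0 ≤ c) (hω : IsCutoffOn ω B d K) (hK : IsOpen K) (hKc : Convex ℝ K) (hd : 0 < d)
    (hKh : K ⊆ Metric.closedBall x₀ h) (hx₀ : x₀ ∈ K) (hp : p ∈ polyFun E k) (hx : x ∈ K) :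
    √(μ.real K) * (|ω x₀| * ‖fderiv ℝ p x‖) ≤
      c * (lpNorm (fderiv ℝ fun y => ω y * p y) 2 (μ.restrict K) +
        2 * (B / d) * (c * lpNorm p 2 (μ.restrict K))) := by
  have hKb : Bornology.IsBounded K := Metric.isBounded_closedBall.subset hKh
  have hh : 0 ≤ h := dist_nonneg.trans (hKh hx₀)
  have hB := hω.bound_nonneg hx
  have hμK : 0 < √(μ.real K) :=
    Real.sqrt_pos.2 (ENNReal.toReal_pos (hK.measure_pos μ ⟨x, hx⟩).ne' hKb.measure_lt_top.ne)
  have hpd := differentiable_of_mem_polyFun hp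
  let P := c * lpNorm p 2 (μ.restrict K) / √(μ.real K)
  have hP : 0 ≤ P := div_nonneg (mul_nonneg hc lpNorm_nonneg) hμK.le
  have hscale : fderiv ℝ (ω x₀ • p) = ω x₀ • fderiv ℝ p :=
    funext fun y => fderiv_const_smul (hpd y) (ω x₀)
  have hdiff : lpNorm ((fderiv ℝ fun y => ω y * p y) - ω x₀ • fderiv ℝ p) 2 (μ.restrict K) ≤
      √(μ.real K) * (2 * (B / d) * P) :=
    lpNorm_two_restrict_le hK.measurableSet hKb.measure_lt_top.ne (by positivity) fun y hy =>
      hω.norm_fderiv_mul_sub_le hK hKc hd hx₀ hy (mem_closedBall_iff_norm.1 (hKh hy)) (hpd y)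
        ((le_div_iff₀' hμK).2 (hinv.sqrt_mul_abs_le hp hy))
        ((le_div_iff₀' hμK).2 (hinv.sqrt_mul_norm_fderiv_le hh hp hy))
  calc √(μ.real K) * (|ω x₀| * ‖fderiv ℝ p x‖) = √(μ.real K) * ‖fderiv ℝ (ω x₀ • p) x‖ := by
        rw [hscale, Pi.smul_apply, norm_smul, Real.norm_eq_abs]
    _ ≤ c * lpNorm (ω x₀ • fderiv ℝ p) 2 (μ.restrict K) := hscale ▸
        hinv.sqrt_mul_norm_fderiv_le_lpNorm_fderiv hc hKb (Submodule.smul_mem _ _ hp) hx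
    _ ≤ c * (lpNorm (fderiv ℝ fun y => ω y * p y) 2 (μ.restrict K) +
        √(μ.real K) * (2 * (B / d) * P)) := by
        gcongr
        exact (lpNorm_le_lpNorm_add_lpNorm_sub (hω.memLp_fderiv_mul hK hKb hp) one_le_two).trans
          (by gcongr)
    _ = c * (lpNorm (fderiv ℝ fun y => ω y * p y) 2 (μ.restrict K) +
        2 * (B / d) * (c * lpNorm p 2 (μ.restrict K))) := by
        rw [mul_left_comm, mul_div_cancel₀ _ hμK.ne']

theorem HasInverseEstimate.sqrt_mul_norm_fderiv_sq_mul_sub_localApprox_le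
    (hinv : HasInverseEstimate μ k c h K) (hc : 0 ≤ c) (hω : IsCutoffOn ω B d K) (hK : IsOpen K)
    (hKc : Convex ℝ K) (hd : 0 < d) (hKh : K ⊆ Metric.closedBall x₀ h) (hx₀ : x₀ ∈ K)
    (hp : p ∈ polyFun E k) (hx : x ∈ K) :
    √(μ.real K) * ‖fderiv ℝ (fun y => ω y ^ 2 * p y - localApprox ω p x₀ y) x‖ ≤
      4 * B * c * (h / d) * lpNorm (fderiv ℝ fun y => ω y * p y) 2 (μ.restrict K) +
        (8 * c ^ 2 + 7 * c) * B ^ 2 * (h / d ^ 2) * lpNorm p 2 (μ.restrict K) := by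
  have hKb : Bornology.IsBounded K := Metric.isBounded_closedBall.subset hKh
  have hh : 0 ≤ h := dist_nonneg.trans (hKh hx₀)
  have hμK : 0 < √(μ.real K) :=
    Real.sqrt_pos.2 (ENNReal.toReal_pos (hK.measure_pos μ ⟨x, hx⟩).ne' hKb.measure_lt_top.ne)
  have hbound := norm_fderiv_sq_mul_sub_localApprox_le hω hK hKc hd hx₀ hx
    (mem_closedBall_iff_norm.1 (hKh hx)) (differentiable_of_mem_polyFun hp)
    ((le_div_iff₀' hμK).2 (hinv.sqrt_mul_abs_le hp hx₀))
    (fun y hy => (le_div_iff₀' hμK).2 (hinv.sqrt_mul_norm_fderiv_le hh hp hy))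
    (fun y hy => (le_div_iff₀' hμK).2
      (hinv.sqrt_mul_abs_mul_norm_fderiv_le hc hω hK hKc hd hKh hx₀ hp hy))
  refine (mul_le_mul_of_nonneg_left hbound hμK.le).trans_eq ?_
  field_simp
  ring

end CutoffGradient

section InterpolationError

variable {ι : Type*} [Fintype ι] (b : AffineBasis ι ℝ E) {g : E → ℝ}

theorem norm_fderiv_sub_lagrangeInterpolation_le [BorelSpace E] [FiniteDimensional ℝ E]
    [μ.IsAddHaarMeasure]
    (hinv : HasInverseEstimate μ k c h (interior (convexHull ℝ (Set.range b)))) (hc : 0 ≤ c)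
    (hh : 0 < h) (hk : k ≠ 0) (hg : ∀ y ∈ convexHull ℝ (Set.range b), |g y| ≤ h * M)
    (hx : x ∈ interior (convexHull ℝ (Set.range b))) (hgx : DifferentiableAt ℝ g x)
    (hgM : ‖fderiv ℝ g x‖ ≤ M) :
    ‖fderiv ℝ (g - lagrangeInterpolation b k g) x‖ ≤
      (1 + c * lebesgueBound (Fintype.card ι) k) * M := by
  have hKb : Bornology.IsBounded (interior (convexHull ℝ (Set.range b))) :=
    ((Set.finite_range b).isCompact_convexHull ℝ).isBounded.subset interior_subset
  have hμK : 0 < μ.real (interior (convexHull ℝ (Set.range b))) :=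
    ENNReal.toReal_pos (isOpen_interior.measure_pos μ ⟨x, hx⟩).ne' hKb.measure_lt_top.ne
  have hI := lagrangeInterpolation_mem_polyFun (k := k) b g
  have hIx : ‖fderiv ℝ (lagrangeInterpolation b k g) x‖ ≤
      c * lebesgueBound (Fintype.card ι) k * M := by
    refine le_of_mul_le_mul_left ?_ hh
    calc h * ‖fderiv ℝ (lagrangeInterpolation b k g) x‖
        ≤ c * (lebesgueBound (Fintype.card ι) k * (h * M)) :=
          hinv.mul_norm_fderiv_le_of_abs_le hc hh.le isOpen_interior.measurableSet hμK hI
            (fun y hy => abs_lagrangeInterpolation_le b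
              (fun a ha => hg _ (lagrangeNode_mem_convexHull hk b ha)) (interior_subset hy)) hx
      _ = h * (c * lebesgueBound (Fintype.card ι) k * M) := by ring
  rw [fderiv_sub hgx (differentiable_of_mem_polyFun hI x), add_mul, one_mul]
  exact (norm_sub_le _ _).trans (add_le_add hgM hIx)

end InterpolationError

end ElementEstimate

section ElementError

variable {n k : ℕ} {ι : Type*} [Fintype ι] (b : AffineBasis ι ℝ (EuclideanSpace ℝ (Fin n)))
  {S : Set (EuclideanSpace ℝ (Fin n))} {g ω p : EuclideanSpace ℝ (Fin n) → ℝ}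
  {x₀ : EuclideanSpace ℝ (Fin n)} {c h d B M : ℝ}

theorem h1Norm_sub_lagrangeInterpolation_le (hk : k ≠ 0) (hS : convexHull ℝ (Set.range b) = S)
    (hc : 0 ≤ c) (hh : 0 < h) (hinv : HasInverseEstimate volume k c h (interior S)) (hM : 0 ≤ M)
    (hg : ∀ x ∈ S, |g x| ≤ h * M) (hgd : ∀ x ∈ interior S, DifferentiableAt ℝ g x)
    (hgM : ∀ x ∈ interior S, ‖fderiv ℝ g x‖ ≤ M) :
    h1Norm (g - lagrangeInterpolation b k g) (interior S) ≤
      ENNReal.ofReal ((h * (1 + lebesgueBound (Fintype.card ι) k) +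
        (1 + c * lebesgueBound (Fintype.card ι) k)) * (√(volume.real (interior S)) * M)) := by
  subst hS
  set K := interior (convexHull ℝ (Set.range b))
  set L := lebesgueBound (Fintype.card ι) k
  have hL : 0 ≤ L := lebesgueBound_nonneg _ _
  have hK : MeasurableSet K := isOpen_interior.measurableSet
  have hKv : volume K ≠ ∞ := (((Set.finite_range b).isCompact_convexHull ℝ).isBounded.subset
    interior_subset).measure_lt_top.ne
  have hl2 : l2Norm (g - lagrangeInterpolation b k g) K ≤
      ENNReal.ofReal (√(volume.real K) * ((1 + L) * (h * M))) :=
    eLpNorm_two_restrict_le_ofReal hK hKv fun x hx =>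
      abs_sub_lagrangeInterpolation_le b hk hg (interior_subset hx)
  have hgrad : gradL2Norm (g - lagrangeInterpolation b k g) K ≤
      ENNReal.ofReal (√(volume.real K) * ((1 + c * L) * M)) := by
    rw [gradL2Norm_eq_eLpNorm_fderiv]
    exact eLpNorm_two_restrict_le_ofReal hK hKv fun x hx =>
      norm_fderiv_sub_lagrangeInterpolation_le b hinv hc hh hk hg hx (hgd x hx) (hgM x hx)
  refine (h1Norm_le_add _ K).trans ((add_le_add hl2 hgrad).trans_eq ?_)
  rw [← ENNReal.ofReal_add (by positivity) (by positivity)]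
  ring_nf

theorem h1Norm_sq_mul_sub_lagrangeInterpolation_le_lpNorm (hk : k ≠ 0)
    (hS : convexHull ℝ (Set.range b) = S) (hc : 0 ≤ c) (hh : 0 < h)
    (hinv : HasInverseEstimate volume k c h (interior S)) (hd : 0 < d)
    (hω : IsCutoffOn ω B d (interior S)) (hωc : ContinuousOn ω S) (hx₀ : x₀ ∈ interior S)
    (hSh : S ⊆ Metric.closedBall x₀ h) (hp : p ∈ polyFun _ k) :
    h1Norm ((fun x => ω x ^ 2 * p x) - lagrangeInterpolation b k fun x => ω x ^ 2 * p x)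
        (interior S) ≤
      ENNReal.ofReal ((h * (1 + lebesgueBound (Fintype.card ι) k) +
        (1 + c * lebesgueBound (Fintype.card ι) k)) *
          (4 * B * c * (h / d) *
              lpNorm (fderiv ℝ fun x => ω x * p x) 2 (volume.restrict (interior S)) +
            (8 * c ^ 2 + 7 * c) * B ^ 2 * (h / d ^ 2) *
              lpNorm p 2 (volume.restrict (interior S)))) := by
  have hSc : Convex ℝ S := hS ▸ convex_convexHull ℝ _
  have hKv : volume (interior S) ≠ ∞ :=
    (Metric.isBounded_closedBall.subset (interior_subset.trans hSh)).measure_lt_top.ne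
  have hv : 0 < √(volume.real (interior S)) :=
    Real.sqrt_pos.2 (ENNReal.toReal_pos (isOpen_interior.measure_pos _ ⟨x₀, hx₀⟩).ne' hKv)
  have hpd := differentiable_of_mem_polyFun hp
  have hq := localApprox_mem_polyFun hk ω hp x₀
  let g x := ω x ^ 2 * p x - localApprox ω p x₀ x
  have hgd : ∀ x ∈ interior S, DifferentiableAt ℝ g x := fun x hx =>
    (hasFDerivAt_sq_mul_sub_localApprox (hω.differentiableAt isOpen_interior hx) (hpd x)
      x₀).differentiableAt
  obtain ⟨N, hNv⟩ : ∃ N, √(volume.real (interior S)) * N = 4 * B * c * (h / d) *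
      lpNorm (fderiv ℝ fun x => ω x * p x) 2 (volume.restrict (interior S)) +
        (8 * c ^ 2 + 7 * c) * B ^ 2 * (h / d ^ 2) * lpNorm p 2 (volume.restrict (interior S)) :=
    ⟨_, mul_div_cancel₀ _ hv.ne'⟩
  have hgN : ∀ x ∈ interior S, ‖fderiv ℝ g x‖ ≤ N := fun x hx =>
    le_of_mul_le_mul_left ((hinv.sqrt_mul_norm_fderiv_sq_mul_sub_localApprox_le hc hω
      isOpen_interior hSc.interior hd (interior_subset.trans hSh) hx₀ hp hx).trans_eq hNv.symm) hv
  have hN : 0 ≤ N := (norm_nonneg _).trans (hgN x₀ hx₀)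
  have hgc : ContinuousOn g S := ((hωc.pow 2).mul hpd.continuous.continuousOn).sub
    (differentiable_of_mem_polyFun hq).continuous.continuousOn
  have hg₀ : g x₀ = 0 := sub_eq_zero.2 (localApprox_self ω p x₀).symm
  have hg : ∀ x ∈ S, |g x| ≤ h * N := fun x hx => by
    have hmean := norm_image_sub_le_of_norm_fderiv_interior_le hSc hgc hgd hgN hx₀ hx
    rw [hg₀, sub_zero, mul_comm] at hmean
    exact hmean.trans (mul_le_mul_of_nonneg_right (mem_closedBall_iff_norm.1 (hSh hx)) hN)
  -- The polynomial `localApprox ω p x₀` is reproduced, so only `g` contributes to the error.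
  rw [← sub_lagrangeInterpolation_sub b hk _ hq, ← hNv]
  exact h1Norm_sub_lagrangeInterpolation_le b hk hS hc hh hinv hN hg hgd hgN

theorem h1Norm_sq_mul_sub_lagrangeInterpolation_le (hk : k ≠ 0)
    (hS : convexHull ℝ (Set.range b) = S) (hc : 0 ≤ c) (hh : 0 < h)
    (hinv : HasInverseEstimate volume k c h (interior S)) (hd : 0 < d)
    (hω : IsCutoffOn ω B d (interior S)) (hωc : ContinuousOn ω S) (hx₀ : x₀ ∈ interior S)
    (hSh : S ⊆ Metric.closedBall x₀ h) (hp : p ∈ polyFun _ k) :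
    h1Norm ((fun x => ω x ^ 2 * p x) - lagrangeInterpolation b k fun x => ω x ^ 2 * p x)
        (interior S) ≤
      ENNReal.ofReal ((h * (1 + lebesgueBound (Fintype.card ι) k) +
        (1 + c * lebesgueBound (Fintype.card ι) k)) * (4 * B * c + (8 * c ^ 2 + 7 * c) * B ^ 2)) *
        (ENNReal.ofReal (h / d) * gradL2Norm (fun x => ω x * p x) (interior S) +
          ENNReal.ofReal (h / d ^ 2) * l2Norm p (interior S)) := by
  have hB : 0 ≤ B := hω.bound_nonneg hx₀
  have hL : 0 ≤ lebesgueBound (Fintype.card ι) k := lebesgueBound_nonneg _ _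
  have hKb : Bornology.IsBounded (interior S) :=
    Metric.isBounded_closedBall.subset (interior_subset.trans hSh)
  have hΓ : 0 ≤ lpNorm (fderiv ℝ fun x => ω x * p x) 2 (volume.restrict (interior S)) :=
    lpNorm_nonneg
  have hX : 0 ≤ lpNorm p 2 (volume.restrict (interior S)) := lpNorm_nonneg
  rw [gradL2Norm_eq_eLpNorm_fderiv, ← ofReal_lpNorm (hω.memLp_fderiv_mul isOpen_interior hKb hp),
    l2Norm, ← ofReal_lpNorm (memLp_restrict_of_mem_polyFun hp hKb 2),
    ← ENNReal.ofReal_mul (by positivity), ← ENNReal.ofReal_mul (by positivity),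
    ← ENNReal.ofReal_add (by positivity) (by positivity), ← ENNReal.ofReal_mul (by positivity)]
  refine (h1Norm_sq_mul_sub_lagrangeInterpolation_le_lpNorm b hk hS hc hh hinv hd hω hωc hx₀ hSh
    hp).trans (ENNReal.ofReal_le_ofReal ?_)
  have hcross : 0 ≤ 4 * B * c * (h / d ^ 2 * lpNorm p 2 (volume.restrict (interior S))) +
      (8 * c ^ 2 + 7 * c) * B ^ 2 *
        (h / d * lpNorm (fderiv ℝ fun x => ω x * p x) 2 (volume.restrict (interior S))) := by
    positivity
  rw [mul_assoc _ (4 * B * c + _)]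
  gcongr
  linarith

end ElementError

theorem SimplicialDecomposition.IsLagrangeInterpolant.h1Norm_sq_mul_sub_le {n k : ℕ} (hk : k ≠ 0)
    {Ω : Set (EuclideanSpace ℝ (Fin n))} {𝒯 : SimplicialDecomposition Ω}
    {ω χ η : EuclideanSpace ℝ (Fin n) → ℝ} (hχ : χ ∈ 𝒯.lagrangeSpace k)
    (hη : 𝒯.IsLagrangeInterpolant k (fun x => ω x ^ 2 * χ x) η)
    {s : Finset (EuclideanSpace ℝ (Fin n))} (hs : s ∈ 𝒯.elements) {c d B : ℝ} (hc : 0 ≤ c)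
    (hh : 0 < simplexDiam s)
    (hinv : HasInverseEstimate volume k c (simplexDiam s) (interior (simplexOf s))) (hd : 0 < d)
    (hω : IsCutoffOn ω B d (interior (simplexOf s))) (hωc : ContinuousOn ω (simplexOf s))
    (hne : (interior (simplexOf s)).Nonempty) :
    h1Norm (fun x => ω x ^ 2 * χ x - η x) (interior (simplexOf s)) ≤
      ENNReal.ofReal ((simplexDiam s * (1 + lebesgueBound (n + 1) k) +
        (1 + c * lebesgueBound (n + 1) k)) * (4 * B * c + (8 * c ^ 2 + 7 * c) * B ^ 2)) *
        (ENNReal.ofReal (simplexDiam s / d) *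
            gradL2Norm (fun x => ω x * χ x) (interior (simplexOf s)) +
          ENNReal.ofReal (simplexDiam s / d ^ 2) * l2Norm χ (interior (simplexOf s))) := by
  obtain ⟨x₀, hx₀⟩ := hne
  obtain ⟨p, hp, hχp⟩ := exists_mem_polyFun_of_mem_lagrangeSpace hχ hs
  have hχp' : Set.EqOn χ p (interior (simplexOf s)) := hχp.mono interior_subset
  have hηI := hη.eqOn_lagrangeInterpolation (g := fun x => ω x ^ 2 * p x) hk hs fun x hx => by
    simp only [hχp hx]
  have hcard : Fintype.card s = n + 1 := (Fintype.card_coe s).trans hs.2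
  have hdiam : simplexOf s ⊆ Metric.closedBall x₀ (simplexDiam s) := fun x hx =>
    Metric.dist_le_diam_of_mem (isCompact_simplexOf s).isBounded hx (interior_subset hx₀)
  rw [h1Norm_congr isOpen_interior fun x hx => congrArg₂ (· - ·)
      (congrArg (ω x ^ 2 * ·) (hχp' hx)) (hηI (interior_subset hx)),
    gradL2Norm_congr isOpen_interior fun x hx => congrArg (ω x * ·) (hχp' hx),
    l2Norm_congr isOpen_interior hχp', ← hcard]
  exact h1Norm_sq_mul_sub_lagrangeInterpolation_le (elementBasis hs) hk
    (convexHull_range_elementBasis hs) hc hh hinv hd hω hωc hx₀ hdiam hp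

theorem theorem2p1_general {n k : ℕ} (hn : 1 ≤ n) (hk : k ≠ 0) {c₁ A : ℝ} (hc₁ : 0 < c₁)
    (hA : 0 < A) (D : ℝ) :
    ∃ C : ℝ, 0 < C ∧
      ∀ Ω : Set (EuclideanSpace ℝ (Fin n)), interior (closure Ω) = Ω →
      ∀ (𝒯 : SimplicialDecomposition Ω) (d : ℝ) (ω : EuclideanSpace ℝ (Fin n) → ℝ),
        ContDiffOn ℝ 2 ω Ω → ContinuousOn ω (closure Ω) →
        (∀ j ≤ 2, wInftySeminorm j ω Ω ≤ ENNReal.ofReal (A * (d ^ j)⁻¹)) →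
      ∀ χ ∈ 𝒯.lagrangeSpace k,
      ∃ η, 𝒯.IsLagrangeInterpolant k (fun x => ω x ^ 2 * χ x) η ∧
        ∀ T ∈ 𝒯.elements, simplexDiam T ≤ d → simplexDiam T ≤ D →
          (∃ x, Metric.closedBall x (c₁ * simplexDiam T / 2) ⊆ simplexOf T) →
          h1Norm (fun x => ω x ^ 2 * χ x - η x) (interior (simplexOf T)) ≤
            ENNReal.ofReal C *
              (ENNReal.ofReal (simplexDiam T / d) *
                  gradL2Norm (fun x => ω x * χ x) (interior (simplexOf T)) +
                ENNReal.ofReal (simplexDiam T / d ^ 2) *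
                  l2Norm χ (interior (simplexOf T))) := by
  obtain ⟨c, hc, hinv⟩ := exists_hasInverseEstimate (EuclideanSpace ℝ (Fin n)) volume k
    (half_pos hc₁)
  have hL : 0 ≤ lebesgueBound (n + 1) k := lebesgueBound_nonneg _ _
  have : (0 : ℝ) < n := Nat.cast_pos.2 hn
  refine ⟨(|D| * (1 + lebesgueBound (n + 1) k) + (1 + c * lebesgueBound (n + 1) k)) *
    (4 * (n ^ 2 * A) * c + (8 * c ^ 2 + 7 * c) * (n ^ 2 * A) ^ 2), by positivity, ?_⟩
  intro Ω hΩ 𝒯 d ω hω hωc hωb χ hχ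
  obtain ⟨η, hη⟩ := 𝒯.exists_isLagrangeInterpolant hk fun x => ω x ^ 2 * χ x
  refine ⟨η, hη, fun T hT hTd hTD ⟨x₀, hx₀⟩ => ?_⟩
  have hh : 0 < simplexDiam T := 𝒯.simplexDiam_pos hn hT
  have hd : 0 < d := hh.trans_le hTd
  have hTΩ : simplexOf T ⊆ closure Ω := 𝒯.simplexOf_subset_closure hT
  have hball : Metric.ball x₀ (c₁ / 2 * simplexDiam T) ⊆ interior (simplexOf T) := by
    rw [div_mul_eq_mul_div]
    exact interior_maximal (Metric.ball_subset_closedBall.trans hx₀) Metric.isOpen_ball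
  have hx₀T := hball (Metric.mem_ball_self (by positivity))
  have hcutoff : IsCutoffOn ω (n ^ 2 * A) d (interior (simplexOf T)) :=
    (isCutoffOn_of_wInftySeminorm_le hn (hΩ ▸ isOpen_interior) hω hA.le hd hωb).mono
      ((interior_mono hTΩ).trans hΩ.subset)
  have hinvT := hinv x₀ _ hh _ hball fun x hx => Metric.dist_le_diam_of_mem
    (isCompact_simplexOf T).isBounded (interior_subset hx) (interior_subset hx₀T)
  refine (hη.h1Norm_sq_mul_sub_le hk hχ hT hc.le hh hinvT hd hcutoff (hωc.mono hTΩ)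
    ⟨x₀, hx₀T⟩).trans ?_
  gcongr
  exact hTD.trans (le_abs_self D)

theorem theorem2p1 (n r : ℕ) (hn : 1 ≤ n) (hr : 2 ≤ r) (c₁ C₁ A D : ℝ)
    (hc₁ : 0 < c₁) (hC₁ : 0 < C₁) (hA : 0 < A) :
    ∃ C : ℝ, 0 < C ∧
      ∀ (Ω : Set (EuclideanSpace ℝ (Fin n))), IsPolyhedralDomain Ω → Metric.diam Ω ≤ D →
      ∀ 𝒯 : SimplicialDecomposition Ω, 𝒯.ShapeRegular c₁ C₁ →
      ∀ (d : ℝ), 0 < d →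
      ∀ ω : EuclideanSpace ℝ (Fin n) → ℝ,
        ContDiffOn ℝ ((⊤ : ℕ∞) : WithTop ℕ∞) ω Ω → ContinuousOn ω (closure Ω) →
        (∀ j ≤ r, wInftySeminorm j ω Ω ≤ ENNReal.ofReal (A * (d ^ j)⁻¹)) →
      ∀ χ ∈ 𝒯.lagrangeSpace (r - 1),
      ∃ η ∈ 𝒯.lagrangeSpace (r - 1),
        𝒯.IsLagrangeInterpolant (r - 1) (fun x => ω x ^ 2 * χ x) η ∧
        ∀ T ∈ 𝒯.elements, simplexDiam T ≤ d →
          h1Norm (fun x => ω x ^ 2 * χ x - η x) (interior (simplexOf T)) ≤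
            ENNReal.ofReal C *
              (ENNReal.ofReal (simplexDiam T / d) *
                  gradL2Norm (fun x => ω x * χ x) (interior (simplexOf T)) +
                ENNReal.ofReal (simplexDiam T / d ^ 2) *
                  l2Norm χ (interior (simplexOf T))) := by
  obtain ⟨C, hC, hmain⟩ := theorem2p1_general hn (Nat.sub_ne_zero_of_lt hr) hc₁ hA D
  refine ⟨C, hC, fun Ω hΩ hD 𝒯 h𝒯 d _ ω hω hωc hωb χ hχ => ?_⟩
  obtain ⟨η, hη, hηT⟩ := hmain Ω hΩ.interior_closure 𝒯 d ω
    (hω.of_le (WithTop.coe_le_coe.2 le_top)) hωc (fun j hj => hωb j (hj.trans hr)) χ hχ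
  exact ⟨η, hη.1, hη, fun T hT hTd =>
    hηT T hT hTd ((𝒯.simplexDiam_le_diam hT).trans hD) (h𝒯 T hT).1⟩
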